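/- **Setting.** Let $d\in\{1,2,3\}$ and let $\Omega\subset\mathbb{R}^d$ be a bounded domain with smooth boundary and outer unit normal $\mathbf n$. Let $\Gamma\subset\Omega$ be a smooth $(d-1)$-dimensional interface with $\Omega\setminus\Gamma=\Omega_1\cup\Omega_2$, where $\Omega_1,\Omega_2$ are non-empty, open and disjoint. Let $c=c_i$ on $\Omega_i$, where $c_i\in C^\infty(\overline{\Omega_i})$ is positive on $\overline{\Omega_i}$, $i=1,2$. Let $\emptyset\ne\omega\subset\Omega$, $T>0$ and $\rho>0$. Let $\hat{\mathcal T}_h$ be a finite conforming simplicial triangulation whose $d$-simplices cover $\Omega$, and let $\mathcal T_h$ consist of the non-empty cells $K=\hat K\cap\Omega$, $\hat K\in\hat{\mathcal T}_h$ a $d$-simplex. Assume that $\mathcal T_h$ is quasi-uniform with mesh size $h>0$: $\operatorname{diam}\hat K\le h$, and (the interior of) each cell $K$ contains a ball of radius $\rho h$. Assume that $\mathcal T_h$ fits $\Gamma$ and $\omega$: the interior of each cell lies in $\Omega_1$ or in $\Omega_2$, and it lies in $\omega$ or is disjoint from $\omega$. For $N\ge1$ put $\Delta t=T/N$, $t_n=n\Delta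 t$, $I_n=(t_n,t_{n+1})$, $Q^n=I_n\times\Omega$, $\Sigma^n=I_n\times\partial\Omega$. Write $(\cdot,\cdot)_X$ and $\|\cdot\|_X$ for the $L^2(X)$ inner product and norm, $v^n_\pm=\lim_{s\to0^+}v(t_n\pm s,\cdot)$ and $[\![v^n]\!]=v^n_+-v^n_-$ for jumps in time, and $[\![\cdot]\!]$ also for jumps across interior facets $F\in\mathcal F_i$ of $\mathcal T_h$. For $k\ge 1$, $q\ge0$ let $V_h^k=\{v\in H^1(\Omega): v|_K \text{ is a polynomial of degree}\le k\ \forall K\in\mathcal T_h\}$, and let $W_h^{k,q}$ be the space of pairs $(y_1,y_2)$ with $y_j|_{Q^n}\in\mathcal P^q(I_n)\otimes V_h^k$ for $n=0,\dots,N-1$. For pairs $\mathbf U=(u_1,u_2)$, $\mathbf Y=(y_1,y_2)$, $\mathbf Z=(z_1,z_2)$ set $$A[\mathbf U,\mathbf Y]=\sum_{n=0}^{N-1}\Big\{(\partial_tu_2,y_1)_{Q^n}+(c^2\nabla u_1,\nabla y_1)_{Q^n}+(\partial_tu_1-u_2,y_2)_{Q^n}-(c^2\nabla u_1\cdot\mathbf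 n,y_1)_{\Sigma^n}\Big\},$$ $$|\mathbf U|_{S_h}^2=\sum_{n=0}^{N-1}\Big\{\int_{I_n}\sum_{F\in\mathcal F_i}h\|[\![c^2\nabla u_1]\!]\cdot\mathbf n\|_F^2\,dt+\|u_2-\partial_tu_1\|_{Q^n}^2+\int_{I_n}\sum_{K\in\mathcal T_h}h^2\|\partial_tu_2-\operatorname{div}(c^2\nabla u_1)\|_K^2\,dt+h^{-1}\|u_1\|_{\Sigma^n}^2\Big\},$$ $$|\mathbf U|_{\uparrow\downarrow}^2=\sum_{n=1}^{N-1}\Big\{\tfrac1{\Delta t}\|[\![u_1^n]\!]\|_\Omega^2+\Delta t\,\|c^2[\![\nabla u_1^n]\!]\|_\Omega^2+\tfrac1{\Delta t}\|[\![u_2^n]\!]\|_\Omega^2\Big\},$$ $$\|\mathbf Z\|_{S_h^*}^2=\sum_{n=0}^{N-1}\Big\{\|z_1\|_{Q^n}^2+\|c\nabla z_1\|_{Q^n}^2+\|z_2\|_{Q^n}^2+h^{-1}\|z_1\|_{\Sigma^n}^2\Big\},$$ $$|||(\mathbf U,\mathbf Z)|||^2=|\mathbf U|_{S_h}^2+|\mathbf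 U|_{\uparrow\downarrow}^2+\sum_{n=0}^{N-1}\|u_1\|_{I_n\times\omega}^2+\|\mathbf Z\|_{S_h^*}^2,$$ $$|||(\mathbf U,\mathbf Z)|||_{\square_c}^2=|||(\mathbf U,\mathbf Z)|||^2+\sum_{n=0}^{N-1}\Big\{\|\partial_tu_2\|_{Q^n}^2+\|c^2\nabla u_1\|_{Q^n}^2+\|\partial_tu_1\|_{Q^n}^2+\|u_2\|_{Q^n}^2+\int_{I_n}\sum_{K\in\mathcal T_h}h^2\|c^2u_1\|_{H^2(K)}^2\,dt\Big\},$$ with values in $[0,\infty]$ (a jump in time whose one-sided $L^2(\Omega)$ traces do not exist counts as $\infty$; products in $[0,\infty]$ use $0\cdot\infty=0$). **Lemma (continuity of $A$).** There are $h_0>0$ and $C>0$, depending only on $\Omega,\Gamma,c,\omega,T$ and $\rho$, such that for every mesh and time partition as above with $h\le h_0$, all $k\ge1$, $q\ge0$, all $\mathbf U=(u_1,u_2)$ with $$\mathbf U|_{Q^n}\in\big[H^1(Q^n)\cap L^2(I_n;H^2(\mathcal T_h))\big]\times H^1(Q^n),\qquad n=0,\dots,N-1,$$ where $H^2(\mathcal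 T_h)$ denotes the functions that are $H^2$ on each cell, and all $\mathbf Y_h\in W_h^{k,q}$, $$A[\mathbf U,\mathbf Y_h]\le C\,|||(\mathbf U,0)|||_{\square_c}\,|||(0,\mathbf Y_h)|||.$$ -/

import Mathlib

noncomputable section

open MeasureTheory Filter Topology Set
open scoped ENNReal ContDiff

namespace WaveDA

/-! ### Weak derivatives and Sobolev regularity -/

/-- `ℝ^d` with the Euclidean norm. -/
abbrev Space (d : ℕ) : Type := EuclideanSpace ℝ (Fin d)

/-- Points `(t, x)` of space-time. -/
abbrev SpaceTime (d : ℕ) : Type := ℝ × Space d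

/-- The direction `∂_t` in space-time. -/
def dirT (d : ℕ) : SpaceTime d := (1, 0)

/-- The direction `∂_{x_i}` in space-time. -/
def dirX {d : ℕ} (i : Fin d) : SpaceTime d := (0, EuclideanSpace.single i 1)

section Weak

variable {V : Type} [NormedAddCommGroup V] [NormedSpace ℝ V] [MeasureSpace V]

/-- `g` is the weak derivative of `f` in direction `v` on the open set `O`. -/
def HasWeakDeriv (O : Set V) (f : V → ℝ) (v : V) (g : V → ℝ) : Prop :=
  LocallyIntegrableOn f O volume ∧ LocallyIntegrableOn g O volume ∧
    ∀ φ : V → ℝ, ContDiff ℝ ∞ φ → HasCompactSupport φ → tsupport φ ⊆ O →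
      ∫ z in O, f z * fderiv ℝ φ z v = -∫ z in O, g z * φ z

open Classical in
/-- The weak derivative of `f` in direction `v` on `O` (unique up to null sets where it exists). -/
def weakDeriv (O : Set V) (f : V → ℝ) (v : V) : V → ℝ :=
  if h : ∃ g, HasWeakDeriv O f v g then h.choose else 0

/-- `f ∈ H¹(O)`. -/
def MemH1 (O : Set V) (f : V → ℝ) : Prop :=
  MemLp f 2 (volume.restrict O) ∧
    ∀ v : V, ∃ g, MemLp g 2 (volume.restrict O) ∧ HasWeakDeriv O f v g

end Weak

/-- `f ∈ L²(I; H²(K))`: on `I × K`, the function and its weak spatial derivatives of order one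
and two are square integrable. -/
def MemL2H2 {d : ℕ} (I : Set ℝ) (K : Set (Space d)) (f : SpaceTime d → ℝ) : Prop :=
  MemLp f 2 (volume.restrict (I ×ˢ K)) ∧
    ∀ i : Fin d, ∃ g, MemLp g 2 (volume.restrict (I ×ˢ K)) ∧
      HasWeakDeriv (I ×ˢ K) f (dirX i) g ∧
      ∀ j : Fin d, ∃ g', MemLp g' 2 (volume.restrict (I ×ˢ K)) ∧
        HasWeakDeriv (I ×ˢ K) g (dirX j) g'

/-- The squared `L²(μ)` norm, with values in `[0, ∞]`. -/
def sqNorm {α : Type} [MeasurableSpace α] (μ : Measure α) (f : α → ℝ) : ℝ≥0∞ :=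
  ∫⁻ z, ‖f z‖ₑ ^ 2 ∂μ

/-- `∫_I ‖w‖²_{H²(K)} dt`. -/
def sqNormL2H2 {d : ℕ} (I : Set ℝ) (K : Set (Space d)) (w : SpaceTime d → ℝ) : ℝ≥0∞ :=
  sqNorm (volume.restrict (I ×ˢ K)) w
    + ∑ i : Fin d, sqNorm (volume.restrict (I ×ˢ K)) (weakDeriv (I ×ˢ K) w (dirX i))
    + ∑ i : Fin d, ∑ j : Fin d, sqNorm (volume.restrict (I ×ˢ K))
        (weakDeriv (I ×ˢ K) (weakDeriv (I ×ˢ K) w (dirX i)) (dirX j))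

/-! ### Surface measure, normals and traces -/

/-- The measure `dS dt` on `I × S`, for `S` a piece of a hypersurface of `ℝ^d`. -/
def surfaceMeasure {d : ℕ} (I : Set ℝ) (S : Set (Space d)) : Measure (SpaceTime d) :=
  (volume.restrict I).prod ((Measure.euclideanHausdorffMeasure (d - 1)).restrict S)

/-- `ν` is the outer unit normal of `O` at `x`: up to arbitrarily thin double cones around the
hyperplane orthogonal to `ν`, the set `O` coincides near `x` with the half-space opposite to
`ν`. -/
def IsOuterNormal {d : ℕ} (O : Set (Space d)) (x ν : Space d) : Prop :=
  ‖ν‖ = 1 ∧ ∀ ε > 0, ∀ᶠ y in 𝓝 x,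
    (inner ℝ (y - x) ν < -ε * ‖y - x‖ → y ∈ O) ∧ (ε * ‖y - x‖ < inner ℝ (y - x) ν → y ∉ O)

open Classical in
/-- The outer unit normal of `O` at a boundary point. -/
def outerNormal {d : ℕ} (O : Set (Space d)) (x : Space d) : Space d :=
  if h : ∃ ν, IsOuterNormal O x ν then h.choose else 0

/-- `g` is the trace on `I × S`, `S ⊆ ∂K`, of `w ∈ L²(I; H¹(K))`: the `L²(I × S)` limit of smooth
functions that converge to `w` in `L²(I; H¹(K))`. -/
def IsTrace {d : ℕ} (I : Set ℝ) (K S : Set (Space d)) (w g : SpaceTime d → ℝ) : Prop :=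
  MemLp g 2 (surfaceMeasure I S) ∧
    ∃ φ : ℕ → SpaceTime d → ℝ, (∀ j, ContDiff ℝ ∞ (φ j)) ∧
      Tendsto (fun j => sqNorm (volume.restrict (I ×ˢ K)) (fun z => φ j z - w z)) atTop (𝓝 0) ∧
      (∀ i : Fin d, Tendsto (fun j => sqNorm (volume.restrict (I ×ˢ K))
        (fun z => fderiv ℝ (φ j) z (dirX i) - weakDeriv (I ×ˢ K) w (dirX i) z)) atTop (𝓝 0)) ∧
      Tendsto (fun j => sqNorm (surfaceMeasure I S) (fun z => φ j z - g z)) atTop (𝓝 0)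

open Classical in
/-- The trace of `w ∈ L²(I; H¹(K))` on `I × S`, `S ⊆ ∂K`. -/
def cellTrace {d : ℕ} (I : Set ℝ) (K S : Set (Space d)) (w : SpaceTime d → ℝ) :
    SpaceTime d → ℝ :=
  if h : ∃ g, IsTrace I K S w g then h.choose else 0

/-- `g` is the one-sided trace in time `lim_{s → 0+} v(t + σ s, ·)` (with `σ = 1` or `σ = -1`) in
`L²(Ω)`; the limit is taken in the mean over `s ∈ (0, ε)`, so that it does not depend on the
representative of `v`. -/
def IsTimeTrace {d : ℕ} (Ω : Set (Space d)) (σ t : ℝ) (v : SpaceTime d → ℝ)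
    (g : Space d → ℝ) : Prop :=
  Tendsto (fun ε : ℝ => (ENNReal.ofReal ε)⁻¹ *
    ∫⁻ s in Ioo 0 ε, ∫⁻ x in Ω, ‖v (t + σ * s, x) - g x‖ₑ ^ 2) (𝓝[>] 0) (𝓝 0)

/-- `‖b (v₊ - v₋)‖²_Ω`, where `v₊` is the trace of `vR` at time `t` from above and `v₋` the trace of
`vL` from below; the value is `∞` if one of these traces does not exist. (The traces are unique up
to null sets, so that the infimum runs over at most one value.) -/
def sqTimeJump {d : ℕ} (Ω : Set (Space d)) (t : ℝ) (b : Space d → ℝ)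
    (vL vR : SpaceTime d → ℝ) : ℝ≥0∞ :=
  ⨅ (g : (Space d → ℝ) × (Space d → ℝ))
    (_ : IsTimeTrace Ω (-1) t vL g.1 ∧ IsTimeTrace Ω 1 t vR g.2),
    ∫⁻ x in Ω, ‖b x * (g.2 x - g.1 x)‖ₑ ^ 2

/-! ### The continuous problem -/

/-- `Ω` lies locally on one side of its boundary, which is a smooth hypersurface. -/
def HasSmoothBoundary {d : ℕ} (Ω : Set (Space d)) : Prop :=
  ∀ x ∈ frontier Ω, ∃ φ : Space d → ℝ, ContDiff ℝ ∞ φ ∧ fderiv ℝ φ x ≠ 0 ∧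
    ∀ᶠ y in 𝓝 x, (y ∈ Ω ↔ φ y < 0) ∧ (y ∈ frontier Ω ↔ φ y = 0)

/-- `Γ` is locally the regular zero set of a smooth function. -/
def IsSmoothHypersurface {d : ℕ} (Γ : Set (Space d)) : Prop :=
  ∀ x ∈ Γ, ∃ φ : Space d → ℝ, ContDiff ℝ ∞ φ ∧ fderiv ℝ φ x ≠ 0 ∧
    ∀ᶠ y in 𝓝 x, (y ∈ Γ ↔ φ y = 0)

/-- The data of the problem: a smooth bounded domain `Ω` that a smooth interface `Γ` splits into
`Ω₁` and `Ω₂`, a positive wave speed that is smooth up to the boundary on each side, a data domain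
`obs` (usually written `ω`) and a final time `T`. -/
structure Medium (d : ℕ) where
  Ω : Set (Space d)
  Ω₁ : Set (Space d)
  Ω₂ : Set (Space d)
  Γ : Set (Space d)
  obs : Set (Space d)
  c₁ : Space d → ℝ
  c₂ : Space d → ℝ
  T : ℝ
  isOpen_Ω : IsOpen Ω
  isConnected_Ω : IsConnected Ω
  isBounded_Ω : Bornology.IsBounded Ω
  smooth_Ω : HasSmoothBoundary Ω
  isOpen_Ω₁ : IsOpen Ω₁
  isOpen_Ω₂ : IsOpen Ω₂
  nonempty_Ω₁ : Ω₁.Nonempty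
  nonempty_Ω₂ : Ω₂.Nonempty
  disjoint_Ω₁_Ω₂ : Disjoint Ω₁ Ω₂
  Γ_subset : Γ ⊆ Ω
  smooth_Γ : IsSmoothHypersurface Γ
  diff_Γ : Ω \ Γ = Ω₁ ∪ Ω₂
  smooth_c₁ : ContDiffOn ℝ ∞ c₁ (closure Ω₁)
  smooth_c₂ : ContDiffOn ℝ ∞ c₂ (closure Ω₂)
  pos_c₁ : ∀ x ∈ closure Ω₁, 0 < c₁ x
  pos_c₂ : ∀ x ∈ closure Ω₂, 0 < c₂ x
  obs_subset : obs ⊆ Ω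
  nonempty_obs : obs.Nonempty
  pos_T : 0 < T

open Classical in
/-- The wave speed. -/
def Medium.c {d : ℕ} (M : Medium d) (x : Space d) : ℝ := if x ∈ M.Ω₁ then M.c₁ x else M.c₂ x

/-! ### The discretization -/

/-- A background triangulation, the mesh size and the number of time steps. -/
structure Discretization (d : ℕ) where
  mesh : Geometry.SimplicialComplex ℝ (Space d)
  h : ℝ
  N : ℕ

section

variable {d : ℕ} (M : Medium d) (D : Discretization d)

/-- The `d`-simplices of the background triangulation that meet `Ω`, given by their vertices. -/
def simplices : Set (Finset (Space d)) :=
  {s | s ∈ D.mesh.faces ∧ s.card = d + 1 ∧ (convexHull ℝ (s : Set (Space d)) ∩ M.Ω).Nonempty}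

/-- The mesh cell cut out of `Ω` by the simplex with vertices `s` (without its boundary). -/
def cell (s : Finset (Space d)) : Set (Space d) :=
  interior (convexHull ℝ (s : Set (Space d))) ∩ M.Ω

/-- The background triangulation covers `Ω`, the resulting mesh of `Ω` is quasi-uniform with mesh
size `h` and regularity parameter `ρ`, and it fits the interface and the data domain. -/
structure Admissible (ρ : ℝ) : Prop where
  pos_h : 0 < D.h
  pos_N : 0 < D.N
  finite : D.mesh.faces.Finite
  covers : M.Ω ⊆ ⋃ s ∈ simplices M D, convexHull ℝ (s : Set (Space d))
  diam_le : ∀ s ∈ simplices M D, Metric.diam (convexHull ℝ (s : Set (Space d))) ≤ D.h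
  inner_ball : ∀ s ∈ simplices M D, ∃ x, Metric.ball x (ρ * D.h) ⊆ cell M s
  fits_interface : ∀ s ∈ simplices M D, cell M s ⊆ M.Ω₁ ∨ cell M s ⊆ M.Ω₂
  fits_data : ∀ s ∈ simplices M D, cell M s ⊆ M.obs ∨ Disjoint (cell M s) M.obs

/-- The time step `Δt`. -/
def dt : ℝ := M.T / D.N

/-- The time interval `I_n = (t_n, t_{n+1})`, `t_n = n Δt`. -/
def slabTime (n : ℕ) : Set ℝ := Ioo (n * dt M D) ((n + 1) * dt M D)

/-- The time slab `Q^n = I_n × Ω`. -/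
def slab (n : ℕ) : Set (SpaceTime d) := slabTime M D n ×ˢ M.Ω

/-- The measure `dS dt` on the lateral boundary `I_n × ∂Ω` of the time slab. -/
def lateralMeasure (n : ℕ) : Measure (SpaceTime d) :=
  surfaceMeasure (slabTime M D n) (frontier M.Ω)

/-- `∂_t u` on the time slab `Q^n`. -/
def timeDeriv (n : ℕ) (u : SpaceTime d → ℝ) : SpaceTime d → ℝ :=
  weakDeriv (slab M D n) u (dirT d)

/-- `∂_{x_i} u` on the time slab `Q^n`. -/
def spaceDeriv (n : ℕ) (i : Fin d) (u : SpaceTime d → ℝ) : SpaceTime d → ℝ :=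
  weakDeriv (slab M D n) u (dirX i)

/-- The `i`-th component of `c² ∇u` on `Q^n`. -/
def flux (n : ℕ) (i : Fin d) (u : SpaceTime d → ℝ) (z : SpaceTime d) : ℝ :=
  M.c z.2 ^ 2 * spaceDeriv M D n i u z

/-- `g` is the trace on `I_n × ∂Ω` of `w`, taken cell by cell. -/
def IsLateralTrace (n : ℕ) (w g : SpaceTime d → ℝ) : Prop :=
  ∀ s ∈ simplices M D,
    IsTrace (slabTime M D n) (cell M s) (frontier M.Ω ∩ closure (cell M s)) w g

open Classical in
/-- The trace on `I_n × ∂Ω` of a function that is piecewise `H¹` in space. -/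
def lateralTrace (n : ℕ) (w : SpaceTime d → ℝ) : SpaceTime d → ℝ :=
  if h : ∃ g, IsLateralTrace M D n w g then h.choose else 0

/-- `c² ∇u · n` on `I_n × ∂Ω`. -/
def lateralFlux (n : ℕ) (u : SpaceTime d → ℝ) (z : SpaceTime d) : ℝ :=
  ∑ i : Fin d, lateralTrace M D n (flux M D n i u) z * outerNormal M.Ω z.2 i

/-! ### Discrete spaces and regularity -/

/-- The finite element space `V_h^k`. -/
def MemFE (k : ℕ) (v : Space d → ℝ) : Prop :=
  MemH1 M.Ω v ∧ ∀ s ∈ simplices M D, ∃ p : MvPolynomial (Fin d) ℝ, p.totalDegree ≤ k ∧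
    ∀ᵐ x ∂volume.restrict (cell M s), v x = MvPolynomial.eval (fun i => x i) p

/-- The fully discrete space: on each time slab an element of `P^q(I_n) ⊗ V_h^k`. -/
def MemFullyDiscrete (k q : ℕ) (y : SpaceTime d → ℝ) : Prop :=
  ∀ n < D.N, ∃ v : Fin (q + 1) → Space d → ℝ, (∀ j, MemFE M D k (v j)) ∧
    ∀ᵐ z ∂volume.restrict (slab M D n), y z = ∑ j : Fin (q + 1), z.1 ^ (j : ℕ) * v j z.2

/-- `U|_{Q^n} ∈ [H¹(Q^n) ∩ L²(I_n; H²(𝒯_h))] × H¹(Q^n)` for all `n`. -/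
def IsRegular (U : (SpaceTime d → ℝ) × (SpaceTime d → ℝ)) : Prop :=
  ∀ n < D.N, MemH1 (slab M D n) U.1 ∧
    (∀ s ∈ simplices M D, MemL2H2 (slabTime M D n) (cell M s) U.1) ∧
    MemH1 (slab M D n) U.2

/-! ### The bilinear form -/

/-- The bilinear form `A[U, Y]`. -/
def formA (U Y : (SpaceTime d → ℝ) × (SpaceTime d → ℝ)) : ℝ :=
  ∑ n ∈ Finset.range D.N,
    ((∫ z in slab M D n, timeDeriv M D n U.2 z * Y.1 z)
      + (∫ z in slab M D n, ∑ i : Fin d, flux M D n i U.1 z * spaceDeriv M D n i Y.1 z)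
      + (∫ z in slab M D n, (timeDeriv M D n U.1 z - U.2 z) * Y.2 z)
      - ∫ z, lateralFlux M D n U.1 z * lateralTrace M D n Y.1 z ∂lateralMeasure M D n)

/-! ### The norms -/

/-- The interior penalty term `J(U, U)`. The sum runs over ordered pairs of distinct simplices; a
pair without a common facet contributes zero, and each interior facet occurs twice. -/
def sqJ (U : (SpaceTime d → ℝ) × (SpaceTime d → ℝ)) : ℝ≥0∞ :=
  ∑ n ∈ Finset.range D.N,
    ∑' p : {p : Finset (Space d) × Finset (Space d) //
        p.1 ∈ simplices M D ∧ p.2 ∈ simplices M D ∧ p.1 ≠ p.2},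
      let F : Set (Space d) := convexHull ℝ (p.1.1 : Set (Space d)) ∩
        convexHull ℝ (p.1.2 : Set (Space d)) ∩ M.Ω
      2⁻¹ * (ENNReal.ofReal D.h * sqNorm (surfaceMeasure (slabTime M D n) F) (fun z =>
        ∑ i : Fin d,
          (cellTrace (slabTime M D n) (cell M p.1.1) F (flux M D n i U.1) z
            - cellTrace (slabTime M D n) (cell M p.1.2) F (flux M D n i U.1) z)
          * outerNormal (convexHull ℝ (p.1.1 : Set (Space d))) z.2 i))

/-- The least squares term `G(U, U)`. -/
def sqG (U : (SpaceTime d → ℝ) × (SpaceTime d → ℝ)) : ℝ≥0∞ :=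
  ∑ n ∈ Finset.range D.N, ∑' s : simplices M D,
    ENNReal.ofReal (D.h ^ 2) *
      sqNorm (volume.restrict (slabTime M D n ×ˢ cell M s)) (fun z =>
        timeDeriv M D n U.2 z - ∑ i : Fin d,
          weakDeriv (slabTime M D n ×ˢ cell M s) (flux M D n i U.1) (dirX i) z)

/-- `I₀(U, U)`. -/
def sqI₀ (U : (SpaceTime d → ℝ) × (SpaceTime d → ℝ)) : ℝ≥0∞ :=
  ∑ n ∈ Finset.range D.N,
    sqNorm (volume.restrict (slab M D n)) (fun z => U.2 z - timeDeriv M D n U.1 z)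

/-- The boundary term `R(U, U)`. -/
def sqR (U : (SpaceTime d → ℝ) × (SpaceTime d → ℝ)) : ℝ≥0∞ :=
  ∑ n ∈ Finset.range D.N,
    ENNReal.ofReal D.h⁻¹ * sqNorm (lateralMeasure M D n) (lateralTrace M D n U.1)

/-- `|U|²_{S_h}`. -/
def sqPrimal (U : (SpaceTime d → ℝ) × (SpaceTime d → ℝ)) : ℝ≥0∞ :=
  sqJ M D U + sqI₀ M D U + sqG M D U + sqR M D U

/-- `‖Z‖²_{S_h^*}`. -/
def sqDual (Z : (SpaceTime d → ℝ) × (SpaceTime d → ℝ)) : ℝ≥0∞ :=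
  ∑ n ∈ Finset.range D.N,
    (sqNorm (volume.restrict (slab M D n)) Z.1
      + ∑ i : Fin d, sqNorm (volume.restrict (slab M D n))
          (fun z => M.c z.2 * spaceDeriv M D n i Z.1 z)
      + sqNorm (volume.restrict (slab M D n)) Z.2
      + ENNReal.ofReal D.h⁻¹ * sqNorm (lateralMeasure M D n) (lateralTrace M D n Z.1))

/-- The seminorm (squared) of the jumps at the interior times `t_n`, `n = 1, …, N - 1`. -/
def sqUpDown (U : (SpaceTime d → ℝ) × (SpaceTime d → ℝ)) : ℝ≥0∞ :=
  ∑ n ∈ Finset.Ico 1 D.N,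
    (ENNReal.ofReal (dt M D)⁻¹ * sqTimeJump M.Ω (n * dt M D) 1 U.1 U.1
      + ENNReal.ofReal (dt M D) * ∑ i : Fin d,
          sqTimeJump M.Ω (n * dt M D) (fun x => M.c x ^ 2)
            (spaceDeriv M D (n - 1) i U.1) (spaceDeriv M D n i U.1)
      + ENNReal.ofReal (dt M D)⁻¹ * sqTimeJump M.Ω (n * dt M D) 1 U.2 U.2)

/-- `|||(U, Z)|||²`. -/
def sqTnorm (U Z : (SpaceTime d → ℝ) × (SpaceTime d → ℝ)) : ℝ≥0∞ :=
  sqPrimal M D U + sqUpDown M D U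
    + (∑ n ∈ Finset.range D.N, sqNorm (volume.restrict (slabTime M D n ×ˢ M.obs)) U.1)
    + sqDual M D Z

/-- `|||(U, Z)|||²_{□_c}`. -/
def sqTnormBox (U Z : (SpaceTime d → ℝ) × (SpaceTime d → ℝ)) : ℝ≥0∞ :=
  sqTnorm M D U Z + ∑ n ∈ Finset.range D.N,
    (sqNorm (volume.restrict (slab M D n)) (timeDeriv M D n U.2)
      + ∑ i : Fin d, sqNorm (volume.restrict (slab M D n)) (flux M D n i U.1)
      + sqNorm (volume.restrict (slab M D n)) (timeDeriv M D n U.1)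
      + sqNorm (volume.restrict (slab M D n)) U.2
      + ∑' s : simplices M D, ENNReal.ofReal (D.h ^ 2) *
          sqNormL2H2 (slabTime M D n) (cell M s) (fun z => M.c z.2 ^ 2 * U.1 z))

/-- The norm `|||(U, Z)|||`, with values in `[0, ∞]`. -/
def tnorm (U Z : (SpaceTime d → ℝ) × (SpaceTime d → ℝ)) : ℝ≥0∞ :=
  sqTnorm M D U Z ^ (1 / 2 : ℝ)

/-- The norm `|||(U, Z)|||_{□_c}`, with values in `[0, ∞]`. -/
def tnormBox (U Z : (SpaceTime d → ℝ) × (SpaceTime d → ℝ)) : ℝ≥0∞ :=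
  sqTnormBox M D U Z ^ (1 / 2 : ℝ)

end

end WaveDA

end

noncomputable section

open MeasureTheory Filter Topology Set
open scoped ENNReal ContDiff

namespace WaveDA

/-! ### Projective coordinates around an interior point -/

section Cone

variable {n : ℕ} (b : OrthonormalBasis (Fin (n + 1)) ℝ (Space (n + 1)))

/-! The form is a sum over time slabs of four integrals, and each is bounded by Cauchy–Schwarz in
space-time; a discrete Cauchy–Schwarz inequality over the slabs then gives the product of the two
norms. The three volume terms need only a positive lower bound for `c`, because the form pairs
`c²∇u₁` with `∇y₁` while the dual norm controls `c∇y₁`. The substance lies in the boundary term: the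
dual norm controls `h^(-1/2) y₁` on `∂Ω`, so the trace of `c²∇u₁` must be bounded by `h^(-1/2)`
times the primal norm, uniformly over all cut cells.

Cut cells are not affine images of a reference element, so the trace inequality is proved directly.
The defining functions of `∂Ω` are nearly linear at a uniform scale (compactness), so for small `h`
a cell that touches `∂Ω` contains the open cone over its boundary piece with vertex at the centre
`x₀` of its inscribed ball (`IsFlatChart.isConeBase`). Along each ray from `x₀` the boundary value
is controlled by an integral over the outer half of the ray (`sq_le_integral_of_hasDerivAt`).
Integration over all rays compares surface measure with Lebesgue measure in the slopes of the rays
(`IsConeBase.dist_le`), and the slopes with volume (`lintegral_ray_le`); the powers of `h` cancel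
and leave a constant depending on `n` and `ρ` only (`IsConeBase.lintegral_sq_le`). Slicing in time
and approximation by smooth functions extend this to traces (`IsTrace.sqNorm_le`).

The norm contains second derivatives of `w = c²u₁`, not first derivatives of the flux. With `c² =
exp G` one has `c²∂ᵢu₁ = ∂ᵢw - (∂ᵢG)w`, so bounds on the first and second derivatives of `G` convert
one into the other (`sqNorm_weakDeriv_exp_mul_le`). -/

/-- The point with first coordinate `z.1` and remaining coordinates `z.2` in the basis `b`. -/
def coordPoint (z : ℝ × Space n) : Space (n + 1) :=
  b.repr.symm (WithLp.toLp 2 (Fin.cons z.1 z.2.ofLp))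

/-- The slopes `x_{j+1} / x_0` of the coordinates in the basis `b`. -/
def slope (x : Space (n + 1)) : Space n :=
  WithLp.toLp 2 fun j => b.repr x j.succ / b.repr x 0

theorem measurePreserving_coordPoint : MeasurePreserving (coordPoint b) volume volume := by
  have h₁ : MeasurePreserving (Prod.map id WithLp.ofLp : ℝ × Space n → ℝ × (Fin n → ℝ)) :=
    (MeasurePreserving.id volume).prod (PiLp.volume_preserving_ofLp (Fin n))
  have h₂ := (volume_preserving_piFinSuccAbove (fun _ : Fin (n + 1) => ℝ) 0).symm
  have h₃ := (b.measurePreserving_repr_symm.comp (PiLp.volume_preserving_toLp _)).comp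
    (h₂.comp h₁)
  refine (congrArg (fun f => MeasurePreserving f volume volume) ?_).mp h₃
  funext z
  simp [coordPoint, MeasurableEquiv.piFinSuccAbove, Fin.insertNthEquiv]

theorem smul_coordPoint (s : ℝ) (θ : Space n) :
    s • coordPoint b (1, θ) = coordPoint b (s, s • θ) := by
  rw [coordPoint, coordPoint, ← map_smul]
  congr 1
  ext j
  refine Fin.cases ?_ (fun j => ?_) j <;> simp

theorem smul_coordPoint_slope {x : Space (n + 1)} (hx : b.repr x 0 ≠ 0) :
    b.repr x 0 • coordPoint b (1, slope b x) = x := by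
  rw [smul_coordPoint, coordPoint, LinearIsometryEquiv.symm_apply_eq]
  ext j
  refine Fin.cases ?_ (fun j => ?_) j
  · simp
  · simp [slope]; field_simp

theorem norm_coordPoint_sub (s : ℝ) (θ θ' : Space n) :
    ‖coordPoint b (s, θ) - coordPoint b (s, θ')‖ = ‖θ - θ'‖ := by
  rw [coordPoint, coordPoint, ← map_sub, LinearIsometryEquiv.norm_map, EuclideanSpace.norm_eq,
    EuclideanSpace.norm_eq, Fin.sum_univ_succ]
  simp

theorem measurable_slope : Measurable (slope b) := by
  refine (PiLp.volume_preserving_toLp (Fin n)).measurable.comp (measurable_pi_lambda _ fun j => ?_)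
  have h : ∀ j, Measurable fun x : Space (n + 1) => b.repr x j := fun j => by
    have : Continuous fun x : Space (n + 1) => b.repr x j := by fun_prop
    exact this.measurable
  exact (h _).div (h _)

/-- The map `(s, θ) ↦ s(1, θ)` has Jacobian `s^n`: at fixed height `s` the substitution `θ ↦ sθ`
costs `s^(-n)`. Keeping away from the vertex, `s > σ`, bounds this factor by `σ^(-n)`. -/
theorem lintegral_ray_le (x₀ : Space (n + 1)) {H : Space (n + 1) → ℝ≥0∞} (hH : Measurable H)
    {σ : ℝ} (hσ : 0 < σ) :
    ∫⁻ θ : Space n, ∫⁻ s in Ioi σ, H (x₀ + s • coordPoint b (1, θ))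
      ≤ ENNReal.ofReal (σ ^ n)⁻¹ * ∫⁻ y, H y := by
  have hm : Measurable (coordPoint b) := (measurePreserving_coordPoint b).measurable
  have hH' : Measurable fun z : ℝ × Space n => H (x₀ + coordPoint b z) :=
    hH.comp (hm.const_add x₀)
  simp_rw [smul_coordPoint]
  rw [lintegral_lintegral_swap]
  swap
  · refine Measurable.aemeasurable ?_
    exact hH'.comp (measurable_snd.prodMk (measurable_snd.smul measurable_fst))
  calc ∫⁻ s in Ioi σ, ∫⁻ θ : Space n, H (x₀ + coordPoint b (s, s • θ))
      ≤ ∫⁻ s in Ioi σ, ENNReal.ofReal (σ ^ n)⁻¹ * ∫⁻ θ : Space n, H (x₀ + coordPoint b (s, θ)) := by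
        refine setLIntegral_mono' measurableSet_Ioi fun s hs => ?_
        have hs0 : 0 < s := hσ.trans hs
        have hsec : Measurable fun θ : Space n => H (x₀ + coordPoint b (s, θ)) :=
          hH'.comp measurable_prodMk_left
        have := lintegral_map (μ := (volume : Measure (Space n))) hsec
          (measurable_const_smul s)
        rw [← this, Measure.map_addHaar_smul volume hs0.ne', lintegral_smul_measure, smul_eq_mul]
        gcongr ?_ * _
        refine ENNReal.ofReal_le_ofReal ?_
        rw [finrank_euclideanSpace, Fintype.card_fin, abs_of_pos (by positivity)]
        gcongr
        exact hs.le
    _ ≤ ∫⁻ s, ENNReal.ofReal (σ ^ n)⁻¹ * ∫⁻ θ : Space n, H (x₀ + coordPoint b (s, θ)) :=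
        setLIntegral_le_lintegral _ _
    _ = ENNReal.ofReal (σ ^ n)⁻¹ * ∫⁻ z : ℝ × Space n, H (x₀ + coordPoint b z) := by
        rw [lintegral_const_mul' _ _ ENNReal.ofReal_ne_top, Measure.volume_eq_prod,
          lintegral_prod _ hH'.aemeasurable]
    _ = ENNReal.ofReal (σ ^ n)⁻¹ * ∫⁻ y, H y := by
        rw [(measurePreserving_coordPoint b).lintegral_comp (f := fun y => H (x₀ + y))
          (hH.comp (measurable_const_add x₀)), lintegral_add_left_eq_self]

end Cone

/-! ### Comparison of surface measures and estimates along a ray -/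

/-- A Lipschitz bound for the inverse of a map bounds the `n`-dimensional surface measure by the
volume of the image. -/
theorem euclideanHausdorffMeasure_le_of_antilipschitz {n m : ℕ} {S : Set (Space m)}
    {θ : Space m → Space n} {L : NNReal}
    (hθ : ∀ x ∈ S, ∀ y ∈ S, dist x y ≤ L * dist (θ x) (θ y)) :
    Measure.euclideanHausdorffMeasure n S ≤ (L : ℝ≥0∞) ^ n * volume (θ '' S) := by
  have hinj : InjOn θ S := fun x hx y hy hxy => by
    have := hθ x hx y hy
    rw [hxy, dist_self, mul_zero] at this
    exact dist_le_zero.1 this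
  have hinv : LeftInvOn (Function.invFunOn θ S) θ S := hinj.leftInvOn_invFunOn
  have hlip : LipschitzOnWith L (Function.invFunOn θ S) (θ '' S) := by
    refine LipschitzOnWith.of_dist_le_mul ?_
    rintro _ ⟨x, hx, rfl⟩ _ ⟨y, hy, rfl⟩
    rw [hinv hx, hinv hy]
    exact hθ x hx y hy
  have h := hlip.hausdorffMeasure_image_le (d := n) (by positivity)
  rw [hinv.image_image] at h
  -- The normalising factor of the Hausdorff measure depends only on its dimension `n`, so it is the
  -- same in `Space m` and in `Space n`, where the normalised measure is the volume.
  have hv := EuclideanSpace.euclideanHausdorffMeasure_eq_volume n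
  rw [← hv, Measure.euclideanHausdorffMeasure_def, Measure.euclideanHausdorffMeasure_def,
    Measure.smul_apply, Measure.smul_apply, ENNReal.smul_def, ENNReal.smul_def, smul_eq_mul,
    smul_eq_mul, mul_left_comm]
  gcongr
  simpa using h

/-- The weight `2s/r - 1` vanishes at `r/2` and equals `1` at `r`, so the fundamental theorem of
calculus for the weight times `p²` leaves only the value at `r`. Young's inequality with parameter
`h` splits the mixed term `2pp'`. -/
theorem sq_le_integral_of_hasDerivAt {p p' : ℝ → ℝ} (hp : ∀ s, HasDerivAt p (p' s) s)
    (hp' : Continuous p') {r h : ℝ} (hr : 0 < r) (hh : 0 < h) :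
    p r ^ 2 ≤ ∫ s in (r / 2)..r, ((2 / r + h⁻¹) * p s ^ 2 + h * p' s ^ 2) := by
  have hpc : Continuous p := continuous_iff_continuousAt.2 fun s => (hp s).continuousAt
  have hq : ∀ s, HasDerivAt (fun s => (2 / r * s - 1) * p s ^ 2)
      (2 / r * p s ^ 2 + (2 / r * s - 1) * (2 * p s * p' s)) s := fun s => by
    have h₁ : HasDerivAt (fun s : ℝ => 2 / r * s - 1) (2 / r) s := by
      simpa using ((hasDerivAt_id s).const_mul (2 / r)).sub_const 1
    refine (h₁.mul ((hp s).pow 2)).congr_deriv ?_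
    simp
  have hint := intervalIntegral.integral_eq_sub_of_hasDerivAt (a := r / 2) (b := r)
    (fun s _ => hq s) (Continuous.intervalIntegrable (by fun_prop) _ _)
  have he : (2 / r * r - 1) * p r ^ 2 - (2 / r * (r / 2) - 1) * p (r / 2) ^ 2 = p r ^ 2 := by
    field_simp; ring
  rw [← he, ← hint]
  refine intervalIntegral.integral_mono_on (by linarith)
    (Continuous.intervalIntegrable (by fun_prop) _ _)
    (Continuous.intervalIntegrable (by fun_prop) _ _) fun s hs => ?_
  have h0 : 0 ≤ 2 / r * s - 1 := by
    have : 2 / r * (r / 2) ≤ 2 / r * s := by gcongr; exact hs.1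
    have h1 : 2 / r * (r / 2) = 1 := by field_simp
    linarith
  have h1 : 2 / r * s - 1 ≤ 1 := by
    have : 2 / r * s ≤ 2 / r * r := by gcongr; exact hs.2
    have h1 : 2 / r * r = 2 := by field_simp
    linarith
  have hyoung : |2 * p s * p' s| ≤ h⁻¹ * p s ^ 2 + h * p' s ^ 2 := by
    have e1 : h⁻¹ * p s ^ 2 + h * p' s ^ 2 - 2 * p s * p' s = h⁻¹ * (p s - h * p' s) ^ 2 := by
      field_simp; ring
    have e2 : h⁻¹ * p s ^ 2 + h * p' s ^ 2 + 2 * p s * p' s = h⁻¹ * (p s + h * p' s) ^ 2 := by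
      field_simp; ring
    have : 0 ≤ h⁻¹ * (p s - h * p' s) ^ 2 := by positivity
    have : 0 ≤ h⁻¹ * (p s + h * p' s) ^ 2 := by positivity
    rw [abs_le]; constructor <;> linarith
  have : (2 / r * s - 1) * (2 * p s * p' s) ≤ 1 * |2 * p s * p' s| :=
    (mul_le_mul_of_nonneg_left (le_abs_self _) h0).trans
      (mul_le_mul_of_nonneg_right h1 (abs_nonneg _))
  linarith

theorem sq_apply_le_sum_sq {d : ℕ} (f : Space d →L[ℝ] ℝ) (η : Space d) :
    f η ^ 2 ≤ ‖η‖ ^ 2 * ∑ i : Fin d, f (EuclideanSpace.single i 1) ^ 2 := by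
  have h : f η = ∑ i, η i * f (EuclideanSpace.single i 1) := by
    conv_lhs => rw [← (EuclideanSpace.basisFun (Fin d) ℝ).sum_repr η]
    simp
  rw [h, EuclideanSpace.norm_sq_eq]
  simpa using Finset.sum_mul_sq_le_sq_mul_sq Finset.univ (fun i => η i)
    (fun i => f (EuclideanSpace.single i 1))

/-! ### The trace inequality on a nearly flat piece of the boundary -/

/-- `S` is a nearly flat surface of diameter at most `h` with approximate normal `e` that is seen
from `x₀` under a non-degenerate angle, and the open cone with base `S` and vertex `x₀` lies
in `K`. -/
structure IsConeBase {d : ℕ} (ρ h : ℝ) (e x₀ : Space d) (K S : Set (Space d)) : Prop where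
  norm_eq : ‖e‖ = 1
  le_inner : ∀ x ∈ S, ρ * h / 4 ≤ inner ℝ e (x - x₀)
  norm_le : ∀ x ∈ S, ‖x - x₀‖ ≤ h
  flat : ∀ x ∈ S, ∀ y ∈ S, |inner ℝ e (x - y)| ≤ ρ / 8 * ‖x - y‖
  segment_mem : ∀ x ∈ S, ∀ t ∈ Ioo (0 : ℝ) 1, x₀ + t • (x - x₀) ∈ K

/-- The constant of the trace inequality. -/
def traceConst (n : ℕ) (ρ : ℝ) : ℝ := (16 / ρ) ^ n * (8 / ρ + 1 + 16 / ρ ^ 2)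

theorem exists_orthonormalBasis_zero_eq {n : ℕ} {e : Space (n + 1)} (he : ‖e‖ = 1) :
    ∃ b : OrthonormalBasis (Fin (n + 1)) ℝ (Space (n + 1)), b 0 = e := by
  have h : Orthonormal ℝ (({0} : Set (Fin (n + 1))).domRestrict fun _ => e) := by
    refine ⟨fun _ => he, fun i j hij => ?_⟩
    exact absurd (Subsingleton.elim i j) hij
  obtain ⟨b, hb⟩ := h.exists_orthonormalBasis_extension_of_card_eq (by simp)
  exact ⟨b, hb 0 rfl⟩

section

variable {n : ℕ} {ρ h : ℝ} {x₀ : Space (n + 1)} {K S : Set (Space (n + 1))}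
  {b : OrthonormalBasis (Fin (n + 1)) ℝ (Space (n + 1))}

theorem IsConeBase.repr_pos (hS : IsConeBase ρ h (b 0) x₀ K S) (hρ : 0 < ρ) (hh : 0 < h)
    {x : Space (n + 1)} (hx : x ∈ S) : 0 < b.repr (x - x₀) 0 := by
  rw [b.repr_apply_apply]
  exact lt_of_lt_of_le (by positivity) (hS.le_inner x hx)

/-- The vector from `x₀` to `x` is its height times `(1, slope)`; its length is at most `h` and its
height at least `ρh/4`. -/
theorem IsConeBase.norm_coordPoint_slope_le (hS : IsConeBase ρ h (b 0) x₀ K S) (hρ : 0 < ρ)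
    (hh : 0 < h) {x : Space (n + 1)} (hx : x ∈ S) :
    ‖coordPoint b (1, slope b (x - x₀))‖ ≤ 4 / ρ := by
  have hr := hS.repr_pos hρ hh hx
  have h₁ := congrArg norm (smul_coordPoint_slope b hr.ne')
  rw [norm_smul, Real.norm_of_nonneg hr.le] at h₁
  have h₂ := hS.norm_le x hx
  have h₃ := hS.le_inner x hx
  rw [← b.repr_apply_apply] at h₃
  rw [le_div_iff₀ hρ]
  have h₄ : ρ * h / 4 * ‖coordPoint b (1, slope b (x - x₀))‖ ≤ h := by
    refine le_trans ?_ (h₁.le.trans h₂)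
    gcongr
  have : h * (‖coordPoint b (1, slope b (x - x₀))‖ * ρ) ≤ h * 4 := by linarith
  exact le_of_mul_le_mul_left this hh

/-- Two points of `S` differ either in the direction of their rays or in height. The first
contribution is at most `h` times the difference of slopes; the second is controlled by flatness and
can be absorbed. Hence the central projection of `S` to slopes has an inverse with Lipschitz
constant `2h`. -/
theorem IsConeBase.dist_le (hS : IsConeBase ρ h (b 0) x₀ K S) (hρ : 0 < ρ) (hh : 0 < h) :
    ∀ x ∈ S, ∀ y ∈ S, dist x y ≤ (2 * h).toNNReal *
      dist (slope b (x - x₀)) (slope b (y - x₀)) := by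
  intro x hx y hy
  have hrx := hS.repr_pos hρ hh hx
  have hry := hS.repr_pos hρ hh hy
  have hrx' : b.repr (x - x₀) 0 ≤ h := by
    rw [b.repr_apply_apply]
    refine (real_inner_le_norm _ _).trans ?_
    rw [b.norm_eq_one, one_mul]
    exact hS.norm_le x hx
  have ex := smul_coordPoint_slope b hrx.ne'
  have ey := smul_coordPoint_slope b hry.ne'
  have hflat : |b.repr (x - x₀) 0 - b.repr (y - x₀) 0| ≤ ρ / 8 * ‖x - y‖ := by
    rw [b.repr_apply_apply, b.repr_apply_apply, ← inner_sub_right, sub_sub_sub_cancel_right]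
    exact hS.flat x hx y hy
  have hP := hS.norm_coordPoint_slope_le hρ hh hy
  have hd := norm_coordPoint_sub b 1 (slope b (x - x₀)) (slope b (y - x₀))
  set a := b.repr (x - x₀) 0
  set a' := b.repr (y - x₀) 0
  set P := coordPoint b (1, slope b (x - x₀))
  set P' := coordPoint b (1, slope b (y - x₀))
  have hxy : x - y = a • (P - P') + (a - a') • P' := by
    rw [smul_sub, sub_smul, ex, ey]; abel
  have hle : ‖x - y‖ ≤ h * ‖P - P'‖ + ρ / 8 * ‖x - y‖ * (4 / ρ) := by
    calc ‖x - y‖ ≤ ‖a • (P - P')‖ + ‖(a - a') • P'‖ := by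
          conv_lhs => rw [hxy]
          exact norm_add_le _ _
      _ ≤ _ := by
          rw [norm_smul, norm_smul, Real.norm_of_nonneg hrx.le, Real.norm_eq_abs]
          gcongr
  -- This is why the flatness constant is `ρ/8`: against the bound `4/ρ` for the ray direction it
  -- leaves exactly half of `‖x - y‖`, which is absorbed on the left.
  have h8 : ρ / 8 * ‖x - y‖ * (4 / ρ) = ‖x - y‖ / 2 := by field_simp; ring
  rw [dist_eq_norm, dist_eq_norm, Real.coe_toNNReal _ (by positivity), ← hd]
  linarith

theorem IsConeBase.measure_inter_slope_preimage_le (hS : IsConeBase ρ h (b 0) x₀ K S) (hρ : 0 < ρ)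
    (hh : 0 < h) (B : Set (Space n)) :
    Measure.euclideanHausdorffMeasure n ((fun x => slope b (x - x₀)) ⁻¹' B ∩ S)
      ≤ ENNReal.ofReal (2 * h) ^ n * volume B := by
  refine (euclideanHausdorffMeasure_le_of_antilipschitz (θ := fun x => slope b (x - x₀))
    (L := (2 * h).toNNReal) fun x hx y hy => hS.dist_le hρ hh x hx.2 y hy.2).trans ?_
  have : (fun x => slope b (x - x₀)) '' ((fun x => slope b (x - x₀)) ⁻¹' B ∩ S) ⊆ B := by
    rintro _ ⟨x, hx, rfl⟩
    exact hx.1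
  gcongr
  exact le_rfl

/-- The one-dimensional estimate is applied to `v` along the ray from `x₀` to `x`, parametrised by
height. The height `r` of `x` is at least `ρh/4`, so the outer half `(r/2, r)` lies in `s > ρh/8`,
and its points belong to `K`. The bound depends on `x` only through its slope. -/
theorem IsConeBase.enorm_sq_le (hS : IsConeBase ρ h (b 0) x₀ K S) (hρ : 0 < ρ) (hh : 0 < h)
    {v : Space (n + 1) → ℝ} (hv : ContDiff ℝ 1 v) {x : Space (n + 1)} (hx : x ∈ S) :
    ‖v x‖ₑ ^ 2 ≤ ∫⁻ s in Ioi (ρ * h / 8), K.indicator (fun y =>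
      ENNReal.ofReal ((8 / ρ + 1 + 16 / ρ ^ 2) * (h⁻¹ * v y ^ 2
        + h * ∑ i, fderiv ℝ v y (EuclideanSpace.single i 1) ^ 2)))
        (x₀ + s • coordPoint b (1, slope b (x - x₀))) := by
  have hr := hS.repr_pos hρ hh hx
  have ex := smul_coordPoint_slope b hr.ne'
  have hP := hS.norm_coordPoint_slope_le hρ hh hx
  have hge := hS.le_inner x hx
  rw [← b.repr_apply_apply] at hge
  set r := b.repr (x - x₀) 0
  set P := coordPoint b (1, slope b (x - x₀))
  have hp : ∀ s, HasDerivAt (fun s : ℝ => v (x₀ + s • P)) (fderiv ℝ v (x₀ + s • P) P) s := by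
    intro s
    have h₁ : HasDerivAt (fun s : ℝ => x₀ + s • P) P s := by
      simpa using ((hasDerivAt_id s).smul_const P).const_add x₀
    exact ((hv.differentiable one_ne_zero _).hasFDerivAt).comp_hasDerivAt s h₁
  have hp' : Continuous fun s : ℝ => fderiv ℝ v (x₀ + s • P) P :=
    ((hv.continuous_fderiv one_ne_zero).comp (by fun_prop)).clm_apply continuous_const
  have hvc : Continuous fun s : ℝ => v (x₀ + s • P) := hv.continuous.comp (by fun_prop)
  have key := sq_le_integral_of_hasDerivAt hp hp' hr hh
  have hxr : x₀ + r • P = x := by rw [ex]; abel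
  rw [hxr] at key
  have hF0 : ∀ s : ℝ, 0 ≤ (2 / r + h⁻¹) * v (x₀ + s • P) ^ 2 + h * (fderiv ℝ v (x₀ + s • P) P) ^ 2 :=
    fun s => by positivity
  calc ‖v x‖ₑ ^ 2 = ENNReal.ofReal (v x ^ 2) := by
        rw [Real.enorm_eq_ofReal_abs, ← ENNReal.ofReal_pow (abs_nonneg _), sq_abs]
    _ ≤ ENNReal.ofReal (∫ s in (r / 2)..r,
          ((2 / r + h⁻¹) * v (x₀ + s • P) ^ 2 + h * (fderiv ℝ v (x₀ + s • P) P) ^ 2)) :=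
        ENNReal.ofReal_le_ofReal key
    _ = ∫⁻ s in Ioo (r / 2) r, ENNReal.ofReal
          ((2 / r + h⁻¹) * v (x₀ + s • P) ^ 2 + h * (fderiv ℝ v (x₀ + s • P) P) ^ 2) := by
        rw [intervalIntegral.integral_of_le (by linarith), ofReal_integral_eq_lintegral_ofReal,
          restrict_Ioo_eq_restrict_Ioc]
        · refine (Continuous.intervalIntegrable ?_ _ _).1
          fun_prop
        · exact ae_of_all _ hF0
    _ ≤ ∫⁻ s in Ioo (r / 2) r, K.indicator (fun y =>
          ENNReal.ofReal ((8 / ρ + 1 + 16 / ρ ^ 2) * (h⁻¹ * v y ^ 2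
          + h * ∑ i, fderiv ℝ v y (EuclideanSpace.single i 1) ^ 2))) (x₀ + s • P) := by
        refine setLIntegral_mono' measurableSet_Ioo fun s hs => ?_
        have hsr : x₀ + s • P ∈ K := by
          have := hS.segment_mem x hx (s / r)
            ⟨div_pos (by linarith [hs.1]) hr, (div_lt_one hr).2 hs.2⟩
          rwa [← ex, smul_smul, div_mul_cancel₀ _ hr.ne'] at this
        rw [indicator_of_mem hsr]
        refine ENNReal.ofReal_le_ofReal ?_
        have h₁ : 2 / r ≤ 8 / ρ * h⁻¹ := by
          rw [div_le_iff₀ hr]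
          have : 8 / ρ * h⁻¹ * (ρ * h / 4) ≤ 8 / ρ * h⁻¹ * r := by gcongr
          have e : 8 / ρ * h⁻¹ * (ρ * h / 4) = 2 := by field_simp; norm_num
          linarith
        have h₂ := sq_apply_le_sum_sq (fderiv ℝ v (x₀ + s • P)) P
        have h₃ : ‖P‖ ^ 2 ≤ 16 / ρ ^ 2 := by
          calc ‖P‖ ^ 2 ≤ (4 / ρ) ^ 2 := by gcongr
            _ = 16 / ρ ^ 2 := by rw [div_pow]; norm_num
        set V := v (x₀ + s • P) ^ 2
        set G := ∑ i, fderiv ℝ v (x₀ + s • P) (EuclideanSpace.single i 1) ^ 2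
        have hV : 0 ≤ V := by positivity
        have hG : 0 ≤ G := by positivity
        have h₄ : (fderiv ℝ v (x₀ + s • P) P) ^ 2 ≤ 16 / ρ ^ 2 * G := h₂.trans (by gcongr)
        calc (2 / r + h⁻¹) * V + h * (fderiv ℝ v (x₀ + s • P) P) ^ 2
            ≤ (8 / ρ * h⁻¹ + h⁻¹) * V + h * (16 / ρ ^ 2 * G) := by gcongr
          -- Nonnegative terms are added so that the function and its gradient carry the same
          -- constant.
          _ ≤ (8 / ρ * h⁻¹ + h⁻¹) * V + h * (16 / ρ ^ 2 * G)
              + (16 / ρ ^ 2 * (h⁻¹ * V) + (8 / ρ + 1) * (h * G)) := by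
              have : 0 ≤ 16 / ρ ^ 2 * (h⁻¹ * V) + (8 / ρ + 1) * (h * G) := by positivity
              linarith
          _ = _ := by ring
    _ ≤ _ := by
        refine lintegral_mono_set fun s hs => ?_
        simp only [mem_Ioi]
        linarith [hs.1]

/-- The pointwise ray bound is integrated over `S` and pushed forward to slopes, where surface
measure is dominated by `(2h)^n` times Lebesgue measure. Returning from rays to volume costs
`(ρh/8)^(-n)`. The product is `(16/ρ)^n`, the first factor of `traceConst`. -/
theorem IsConeBase.lintegral_sq_le {e : Space (n + 1)} (hS : IsConeBase ρ h e x₀ K S) (hρ : 0 < ρ)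
    (hh : 0 < h) (hK : IsOpen K) (hSm : MeasurableSet S) {v : Space (n + 1) → ℝ}
    (hv : ContDiff ℝ 1 v) :
    ∫⁻ x in S, ‖v x‖ₑ ^ 2 ∂Measure.euclideanHausdorffMeasure n ≤
      ENNReal.ofReal (traceConst n ρ) * ∫⁻ y in K, ENNReal.ofReal (h⁻¹ * v y ^ 2
        + h * ∑ i, fderiv ℝ v y (EuclideanSpace.single i 1) ^ 2) := by
  obtain ⟨b, rfl⟩ := exists_orthonormalBasis_zero_eq hS.norm_eq
  set C₁ : ℝ := 8 / ρ + 1 + 16 / ρ ^ 2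
  have hC₁ : 0 ≤ C₁ := by positivity
  set F : Space (n + 1) → ℝ≥0∞ := fun y => ENNReal.ofReal (C₁ * (h⁻¹ * v y ^ 2
        + h * ∑ i, fderiv ℝ v y (EuclideanSpace.single i 1) ^ 2)) with hF
  have hFm : Measurable F := by
    have := hv.continuous
    have := hv.continuous_fderiv one_ne_zero
    refine ENNReal.measurable_ofReal.comp (Continuous.measurable ?_)
    fun_prop
  have hH : Measurable (K.indicator F) := hFm.indicator hK.measurableSet
  have hθ : Measurable fun x => slope b (x - x₀) :=
    (measurable_slope b).comp (measurable_sub_const x₀)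
  have hΦ : Measurable fun θ : Space n =>
      ∫⁻ s in Ioi (ρ * h / 8), K.indicator F (x₀ + s • coordPoint b (1, θ)) := by
    refine Measurable.lintegral_prod_right' (f := fun z : Space n × ℝ =>
      K.indicator F (x₀ + z.2 • coordPoint b (1, z.1))) ?_
    refine hH.comp (Measurable.const_add (measurable_snd.smul ?_) x₀)
    exact (measurePreserving_coordPoint b).measurable.comp
      (measurable_const.prodMk measurable_fst)
  have hle : ((Measure.euclideanHausdorffMeasure n).restrict S).map (fun x => slope b (x - x₀))
      ≤ (ENNReal.ofReal (2 * h) ^ n) • (volume : Measure (Space n)) := by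
    refine Measure.le_iff.2 fun B hB => ?_
    rw [Measure.map_apply hθ hB, Measure.restrict_apply (hθ hB), Measure.smul_apply, smul_eq_mul]
    exact hS.measure_inter_slope_preimage_le hρ hh B
  calc ∫⁻ x in S, ‖v x‖ₑ ^ 2 ∂Measure.euclideanHausdorffMeasure n
      ≤ ∫⁻ x in S, (∫⁻ s in Ioi (ρ * h / 8),
          K.indicator F (x₀ + s • coordPoint b (1, slope b (x - x₀))))
          ∂Measure.euclideanHausdorffMeasure n :=
        setLIntegral_mono' hSm fun x hx => hS.enorm_sq_le hρ hh hv hx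
    _ = ∫⁻ θ, (∫⁻ s in Ioi (ρ * h / 8), K.indicator F (x₀ + s • coordPoint b (1, θ)))
          ∂((Measure.euclideanHausdorffMeasure n).restrict S).map
            (fun x => slope b (x - x₀)) := (lintegral_map hΦ hθ).symm
    _ ≤ ENNReal.ofReal (2 * h) ^ n * ∫⁻ θ, (∫⁻ s in Ioi (ρ * h / 8),
          K.indicator F (x₀ + s • coordPoint b (1, θ))) := by
        refine (lintegral_mono' hle le_rfl).trans_eq ?_
        rw [lintegral_smul_measure, smul_eq_mul]
    _ ≤ ENNReal.ofReal (2 * h) ^ n * (ENNReal.ofReal ((ρ * h / 8) ^ n)⁻¹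
          * ∫⁻ y, K.indicator F y) := by
        gcongr
        exact lintegral_ray_le b x₀ hH (by positivity)
    _ = _ := by
        rw [lintegral_indicator hK.measurableSet, hF]
        simp_rw [ENNReal.ofReal_mul hC₁]
        rw [lintegral_const_mul' _ _ ENNReal.ofReal_ne_top, ← mul_assoc, ← mul_assoc,
          ← ENNReal.ofReal_pow (by positivity), ← ENNReal.ofReal_mul (by positivity),
          ← ENNReal.ofReal_mul (by positivity)]
        congr 2
        rw [traceConst, ← inv_pow, ← mul_pow]
        congr 2
        field_simp
        norm_num

/-- The slopes of `S` fill at most a ball of finite volume. Finiteness is what makes the product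
with the time measure amenable to Tonelli's theorem. -/
theorem IsConeBase.measure_lt_top {e : Space (n + 1)} (hS : IsConeBase ρ h e x₀ K S) (hρ : 0 < ρ)
    (hh : 0 < h) : Measure.euclideanHausdorffMeasure n S < ⊤ := by
  obtain ⟨b, rfl⟩ := exists_orthonormalBasis_zero_eq hS.norm_eq
  have hsub : S ⊆ (fun x => slope b (x - x₀)) ⁻¹' Metric.closedBall 0 (4 / ρ + 1) ∩ S := by
    intro x hx
    refine ⟨?_, hx⟩
    have h₁ := hS.norm_coordPoint_slope_le hρ hh hx
    have h₂ := norm_coordPoint_sub b 1 (slope b (x - x₀)) 0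
    have h₃ : ‖coordPoint b (1, (0 : Space n))‖ = 1 := by
      rw [coordPoint, LinearIsometryEquiv.norm_map, EuclideanSpace.norm_eq, Fin.sum_univ_succ]
      simp
    rw [sub_zero] at h₂
    rw [mem_preimage, mem_closedBall_zero_iff, ← h₂]
    exact (norm_sub_le _ _).trans (by rw [h₃]; gcongr)
  refine (measure_mono hsub).trans_lt ((hS.measure_inter_slope_preimage_le hρ hh _).trans_lt ?_)
  exact ENNReal.mul_lt_top (ENNReal.pow_lt_top ENNReal.ofReal_lt_top)
    (measure_closedBall_lt_top)

end

/-! ### Cells at a smooth boundary -/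

/-- On `B`, the set `Ω` is the sublevel set of a function that deviates by at most `ε` from the
linear function with gradient `e`. -/
structure IsFlatChart {d : ℕ} (Ω : Set (Space d)) (ε : ℝ) (B : Set (Space d)) (ψ : Space d → ℝ)
    (e : Space d) : Prop where
  norm_eq : ‖e‖ = 1
  approx : ∀ y ∈ B, ∀ z ∈ B, |ψ y - ψ z - inner ℝ e (y - z)| ≤ ε * ‖y - z‖
  mem_iff : ∀ y ∈ B, y ∈ Ω ↔ ψ y < 0
  frontier_iff : ∀ y ∈ B, y ∈ frontier Ω ↔ ψ y = 0

theorem HasSmoothBoundary.exists_isFlatChart_nhds {d : ℕ} {Ω : Set (Space d)}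
    (hΩ : HasSmoothBoundary Ω) {ε : ℝ} (hε : 0 < ε) {x : Space d} (hx : x ∈ frontier Ω) :
    ∃ B, IsOpen B ∧ x ∈ B ∧ ∃ ψ e, IsFlatChart Ω ε B ψ e := by
  obtain ⟨φ, hφ, hne, hev⟩ := hΩ x hx
  set l := fderiv ℝ φ x with hl
  have hl0 : 0 < ‖l‖ := norm_pos_iff.2 hne
  have hstrict : HasStrictFDerivAt φ l x := hφ.contDiffAt.hasStrictFDerivAt (by simp)
  -- Dividing the defining function by the norm `‖l‖` of its differential makes the gradient a unit
  -- vector, so accuracy `ε` afterwards requires `ε‖l‖` here.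
  obtain ⟨A, hA, happ⟩ := hstrict.approximates_deriv_on_nhds (c := (ε * ‖l‖).toNNReal)
    (Or.inr (Real.toNNReal_pos.2 (by positivity)))
  obtain ⟨B, hBs, hBo, hxB⟩ := mem_nhds_iff.1 (inter_mem hA hev)
  refine ⟨B, hBo, hxB, fun y => ‖l‖⁻¹ * φ y,
    ‖l‖⁻¹ • (InnerProductSpace.toDual ℝ (Space d)).symm l, ?_, ?_, ?_, ?_⟩
  · rw [norm_smul, LinearIsometryEquiv.norm_map, norm_inv, norm_norm, inv_mul_cancel₀ hl0.ne']
  · intro y hy z hz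
    have h := happ y (hBs hy).1 z (hBs hz).1
    rw [Real.coe_toNNReal _ (by positivity), Real.norm_eq_abs] at h
    rw [real_inner_smul_left, InnerProductSpace.toDual_symm_apply, ← mul_sub, ← mul_sub, abs_mul,
      abs_of_pos (inv_pos.2 hl0), inv_mul_le_iff₀ hl0]
    linarith
  · intro y hy
    rw [(hBs hy).2.1, mul_neg_iff]
    have := inv_pos.2 hl0
    constructor
    · exact fun h => Or.inl ⟨this, h⟩
    · rintro (h | h)
      · exact h.2
      · linarith [h.1]
  · intro y hy
    rw [(hBs hy).2.2, mul_eq_zero, or_iff_right (inv_pos.2 hl0).ne']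

/-- The boundary is compact, so a Lebesgue number of the cover by local charts gives one radius for
all boundary points. This radius determines the threshold `h₀`. -/
theorem HasSmoothBoundary.exists_isFlatChart_ball {d : ℕ} {Ω : Set (Space d)}
    (hΩ : HasSmoothBoundary Ω) (hb : Bornology.IsBounded Ω) {ε : ℝ} (hε : 0 < ε) :
    ∃ r > 0, ∀ x ∈ frontier Ω, ∃ ψ e, IsFlatChart Ω ε (Metric.ball x r) ψ e := by
  have hc : IsCompact (frontier Ω) :=
    Metric.isCompact_of_isClosed_isBounded isClosed_frontier
      (hb.closure.subset frontier_subset_closure)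
  choose B hBo hxB ψ e hchart using
    fun x : frontier Ω => hΩ.exists_isFlatChart_nhds hε x.2
  obtain ⟨r, hr, hleb⟩ := lebesgue_number_lemma_of_metric hc hBo
    (fun x hx => mem_iUnion.2 ⟨⟨x, hx⟩, hxB ⟨x, hx⟩⟩)
  refine ⟨r, hr, fun x hx => ?_⟩
  obtain ⟨i, hi⟩ := hleb x hx
  exact ⟨ψ i, e i, (hchart i).norm_eq, fun y hy z hz => (hchart i).approx y (hi hy) z (hi hz),
    fun y hy => (hchart i).mem_iff y (hi hy), fun y hy => (hchart i).frontier_iff y (hi hy)⟩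

/-- A convex set of diameter at most `h` that contains a ball of radius `ρ h` inside `Ω` is a cone
over its boundary piece, if the boundary of `Ω` is flat enough at scale `h`. -/
theorem IsFlatChart.isConeBase {d : ℕ} {Ω B : Set (Space d)} {ρ h : ℝ} {ψ : Space d → ℝ}
    {e x₀ : Space d} (hc : IsFlatChart Ω (ρ / 8) B ψ e) (hρ : 0 < ρ) (hh : 0 < h)
    {T : Set (Space d)} (hT : Convex ℝ T) (hTc : IsClosed T) (hTB : T ⊆ B)
    (hdiam : ∀ x ∈ T, ∀ y ∈ T, ‖x - y‖ ≤ h)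
    (hball : Metric.ball x₀ (ρ * h) ⊆ interior T ∩ Ω) :
    IsConeBase ρ h e x₀ (interior T ∩ Ω) (frontier Ω ∩ closure (interior T ∩ Ω)) := by
  have hcl : closure (interior T ∩ Ω) ⊆ T :=
    closure_minimal (inter_subset_left.trans interior_subset) hTc
  have hx₀ : x₀ ∈ interior T ∩ Ω := hball (Metric.mem_ball_self (by positivity))
  have hx₀T : x₀ ∈ T := interior_subset hx₀.1
  have hinner : ∀ x ∈ frontier Ω ∩ closure (interior T ∩ Ω), ρ * h / 4 ≤ inner ℝ e (x - x₀) := by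
    intro x hx
    have hxT := hcl hx.2
    -- Moving from `x₀` by `ρh/2` along `e` stays in the inscribed ball, hence where `ψ < 0`, while
    -- `ψ x = 0`. With error at most `ρh/8` this gives height at least `3ρh/8`, more than the
    -- required `ρh/4`.
    have hy : x₀ + (ρ * h / 2) • e ∈ interior T ∩ Ω := by
      refine hball ?_
      rw [Metric.mem_ball, dist_eq_norm, add_sub_cancel_left, norm_smul, hc.norm_eq,
        Real.norm_of_nonneg (by positivity)]
      have : 0 < ρ * h := by positivity
      linarith
    have hyT := interior_subset hy.1
    have h₁ := hc.approx _ (hTB hyT) x (hTB hxT)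
    rw [(hc.frontier_iff x (hTB hxT)).1 hx.1] at h₁
    have h₂ := (hc.mem_iff _ (hTB hyT)).1 hy.2
    have h₃ := hdiam _ hyT x hxT
    have h₄ : inner ℝ e (x₀ + (ρ * h / 2) • e - x) = ρ * h / 2 - inner ℝ e (x - x₀) := by
      have : x₀ + (ρ * h / 2) • e - x = (ρ * h / 2) • e - (x - x₀) := by abel
      rw [this, inner_sub_right, real_inner_smul_right, real_inner_self_eq_norm_sq, hc.norm_eq]
      ring
    rw [h₄] at h₁
    have h₅ := (abs_le.1 h₁).1
    have h₆ : ρ / 8 * ‖x₀ + (ρ * h / 2) • e - x‖ ≤ ρ / 8 * h := by gcongr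
    have h₇ : 0 < ρ * h := by positivity
    linarith
  refine ⟨hc.norm_eq, hinner, fun x hx => hdiam x (hcl hx.2) x₀ hx₀T, fun x hx y hy => ?_,
    fun x hx t ht => ?_⟩
  · have h₁ := hc.approx x (hTB (hcl hx.2)) y (hTB (hcl hy.2))
    rwa [(hc.frontier_iff x (hTB (hcl hx.2))).1 hx.1,
      (hc.frontier_iff y (hTB (hcl hy.2))).1 hy.1, sub_zero, zero_sub, abs_neg] at h₁
  · have hxT := hcl hx.2
    have hmem : x₀ + t • (x - x₀) ∈ interior T := by
      have := hT.add_smul_sub_mem_interior hxT hx₀.1 (t := 1 - t)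
        ⟨by linarith [ht.2], by linarith [ht.1]⟩
      convert this using 1
      module
    refine ⟨hmem, ?_⟩
    have hmT := interior_subset hmem
    rw [hc.mem_iff _ (hTB hmT)]
    -- At the point with parameter `t`, the linear part of `ψ` is at most `-(1-t)ρh/4` and the error
    -- at most `(1-t)ρh/8`, so `ψ` is negative.
    have h₁ := hc.approx _ (hTB hmT) x (hTB hxT)
    rw [(hc.frontier_iff x (hTB hxT)).1 hx.1] at h₁
    have e₁ : x₀ + t • (x - x₀) - x = -((1 - t) • (x - x₀)) := by module
    have ht' : 0 < 1 - t := by linarith [ht.2]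
    rw [e₁, inner_neg_right, real_inner_smul_right, norm_neg, norm_smul,
      Real.norm_of_nonneg ht'.le] at h₁
    have h₂ := (abs_le.1 h₁).2
    have h₃ := mul_le_mul_of_nonneg_left (hinner x hx) ht'.le
    have h₄ := mul_le_mul_of_nonneg_left (hdiam x hxT x₀ hx₀T) ht'.le
    have h₅ := mul_le_mul_of_nonneg_left h₄ (show 0 ≤ ρ / 8 by positivity)
    have h₆ : 0 < (1 - t) * (ρ * h) := by positivity
    nlinarith

/-! ### The cut mesh: conical cells, covering and disjointness -/

section

variable {d : ℕ} (M : Medium d)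

theorem exists_isConeBase_cell (hd : 1 ≤ d) {ρ : ℝ} (hρ : 0 < ρ) :
    ∃ h₀ > 0, ∀ D : Discretization d, Admissible M D ρ → D.h ≤ h₀ → ∀ s ∈ simplices M D,
      ∃ e x₀, IsConeBase ρ D.h e x₀ (cell M s) (frontier M.Ω ∩ closure (cell M s)) := by
  obtain ⟨r, hr, hchart⟩ := M.smooth_Ω.exists_isFlatChart_ball M.isBounded_Ω
    (show 0 < ρ / 8 by positivity)
  -- With `h ≤ r/2 < r`, a simplex that contains a boundary point lies in the chart ball around it.
  refine ⟨r / 2, by positivity, fun D hD hle s hs => ?_⟩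
  rcases (frontier M.Ω ∩ closure (cell M s)).eq_empty_or_nonempty with hS | ⟨x, hx⟩
  · rw [hS]
    -- For an empty boundary piece any unit vector serves as the normal.
    exact ⟨EuclideanSpace.single ⟨0, hd⟩ 1, 0, by simp, by simp, by simp, by simp, by simp⟩
  · obtain ⟨ψ, e, hc⟩ := hchart x hx.1
    obtain ⟨x₀, hx₀⟩ := hD.inner_ball s hs
    have hTcomp : IsCompact (convexHull ℝ (s : Set (Space d))) :=
      s.finite_toSet.isCompact_convexHull ℝ
    have hdiam : ∀ y ∈ convexHull ℝ (s : Set (Space d)), ∀ z ∈ convexHull ℝ (s : Set (Space d)),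
        ‖y - z‖ ≤ D.h := fun y hy z hz => by
      rw [← dist_eq_norm]
      exact (Metric.dist_le_diam_of_mem hTcomp.isBounded hy hz).trans (hD.diam_le s hs)
    have hxT : x ∈ convexHull ℝ (s : Set (Space d)) :=
      closure_minimal (inter_subset_left.trans interior_subset) hTcomp.isClosed hx.2
    refine ⟨e, x₀, hc.isConeBase hρ hD.pos_h (convex_convexHull ℝ _) hTcomp.isClosed
      (fun y hy => ?_) hdiam hx₀⟩
    rw [Metric.mem_ball, dist_eq_norm]
    exact (hdiam y hy x hxT).trans_lt (by linarith)

variable {M} {D : Discretization d} {ρ : ℝ}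

theorem isOpen_cell (s : Finset (Space d)) : IsOpen (cell M s) :=
  isOpen_interior.inter M.isOpen_Ω

theorem Admissible.finite_simplices (hD : Admissible M D ρ) : (simplices M D).Finite :=
  hD.finite.subset fun _ hs => hs.1

theorem Admissible.interior_nonempty (hD : Admissible M D ρ) (hρ : 0 < ρ) {s : Finset (Space d)}
    (hs : s ∈ simplices M D) : (interior (convexHull ℝ (s : Set (Space d)))).Nonempty := by
  obtain ⟨x, hx⟩ := hD.inner_ball s hs
  exact ⟨x, (hx (Metric.mem_ball_self (mul_pos hρ hD.pos_h))).1⟩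

/-- Each simplex is the closure of its interior, so points of the open set `Ω` in it are limits of
the cell. The finite union of closed cells therefore contains the closure of `Ω`. -/
theorem Admissible.frontier_subset (hD : Admissible M D ρ) (hρ : 0 < ρ) :
    frontier M.Ω ⊆ ⋃ s ∈ simplices M D, frontier M.Ω ∩ closure (cell M s) := by
  have hcl : closure M.Ω ⊆ ⋃ s ∈ simplices M D, closure (cell M s) := by
    have hsub : M.Ω ⊆ ⋃ s ∈ simplices M D, closure (cell M s) := by
      intro x hx
      obtain ⟨s, hs, hxs⟩ := mem_iUnion₂.1 (hD.covers hx)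
      refine mem_iUnion₂.2 ⟨s, hs, ?_⟩
      have h₁ : x ∈ closure (interior (convexHull ℝ (s : Set (Space d)))) := by
        rw [(convex_convexHull ℝ _).closure_interior_eq_closure_of_nonempty_interior
          (hD.interior_nonempty hρ hs)]
        exact subset_closure hxs
      exact M.isOpen_Ω.closure_inter ⟨h₁, hx⟩
    exact closure_minimal hsub (hD.finite_simplices.isClosed_biUnion fun _ _ => isClosed_closure)
  intro x hx
  obtain ⟨s, hs, hxs⟩ := mem_iUnion₂.1 (hcl (frontier_subset_closure hx))
  exact mem_iUnion₂.2 ⟨s, hs, hx, hxs⟩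

/-- The boundary of a convex set is a null set, so almost every point of `Ω` is interior to a
simplex containing it. -/
theorem Admissible.ae_mem_cell (hD : Admissible M D ρ) :
    ∀ᵐ x ∂volume.restrict M.Ω, ∃ s ∈ simplices M D, x ∈ cell M s := by
  have h₀ : ∀ᵐ x ∂volume.restrict M.Ω, ∀ s ∈ simplices M D,
      x ∉ frontier (convexHull ℝ (s : Set (Space d))) := by
    refine (ae_ball_iff hD.finite_simplices.countable).2 fun s _ => ?_
    refine ae_restrict_of_ae (measure_eq_zero_iff_ae_notMem.1 ?_)
    exact (convex_convexHull ℝ _).addHaar_frontier volume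
  filter_upwards [h₀, ae_restrict_mem M.isOpen_Ω.measurableSet] with x hx hxΩ
  obtain ⟨s, hs, hxs⟩ := mem_iUnion₂.1 (hD.covers hxΩ)
  refine ⟨s, hs, ?_, hxΩ⟩
  by_contra hni
  exact hx s hs ⟨subset_closure hxs, hni⟩

/-- Two simplices of the complex meet in the hull of their common vertices. For distinct
`d`-simplices these are at most `d` points, too few to span the space affinely, so the hull has no
interior. -/
theorem pairwiseDisjoint_cell :
    (simplices M D).PairwiseDisjoint (cell M) := by
  intro s hs t ht hst
  refine Set.disjoint_left.2 fun x hxs hxt => ?_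
  have hint : (interior (convexHull ℝ ((s : Set (Space d)) ∩ t))).Nonempty :=
    ⟨x, interior_mono (D.mesh.inter_subset_convexHull hs.1 ht.1)
      (by rw [interior_inter]; exact ⟨hxs.1, hxt.1⟩)⟩
  rw [interior_convexHull_nonempty_iff_affineSpan_eq_top] at hint
  classical
  have hlt : (s ∩ t).card < d + 1 := by
    rw [← hs.2.1]
    refine Finset.card_lt_card (Finset.inter_subset_left.ssubset_of_ne fun h => hst ?_)
    exact Finset.eq_of_subset_of_card_le (Finset.inter_eq_left.1 h) (by rw [hs.2.1, ht.2.1])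
  rw [← Finset.coe_inter] at hint
  have hne : (s ∩ t).Nonempty := by
    rw [Finset.nonempty_iff_ne_empty]
    intro h
    rw [h, Finset.coe_empty, AffineSubspace.span_empty] at hint
    exact bot_ne_top hint
  obtain ⟨m, hm⟩ : ∃ m, (s ∩ t).card = m + 1 := Nat.exists_eq_succ_of_ne_zero hne.card_pos.ne'
  have hr := finrank_vectorSpan_image_finset_le ℝ (id : Space d → Space d) (s ∩ t) hm
  rw [Finset.image_id, ← direction_affineSpan, hint, AffineSubspace.direction_top, finrank_top,
    finrank_euclideanSpace, Fintype.card_fin] at hr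
  omega

end

/-! ### The trace inequality in space-time -/

theorem enorm_sq_eq_ofReal (a : ℝ) : ‖a‖ₑ ^ 2 = ENNReal.ofReal (a ^ 2) := by
  rw [Real.enorm_eq_ofReal_abs, ← ENNReal.ofReal_pow (abs_nonneg _), sq_abs]

section

variable {α : Type} [MeasurableSpace α] {μ : Measure α}

theorem sqNorm_mono_ae {f g : α → ℝ} (h : ∀ᵐ z ∂μ, |f z| ≤ |g z|) : sqNorm μ f ≤ sqNorm μ g := by
  refine lintegral_mono_ae (h.mono fun z hz => ?_)
  rw [enorm_sq_eq_ofReal, enorm_sq_eq_ofReal]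
  exact ENNReal.ofReal_le_ofReal (sq_le_sq.2 hz)

theorem sqNorm_const_mul (a : ℝ) (f : α → ℝ) :
    sqNorm μ (fun z => a * f z) = ENNReal.ofReal (a ^ 2) * sqNorm μ f := by
  rw [sqNorm, sqNorm, ← lintegral_const_mul' _ _ ENNReal.ofReal_ne_top]
  simp_rw [enorm_sq_eq_ofReal, mul_pow, ENNReal.ofReal_mul (sq_nonneg a)]

theorem sqNorm_le_add {f u v : α → ℝ} (hv : AEMeasurable v μ)
    (h : ∀ᵐ z ∂μ, |f z| ≤ |u z| + |v z|) :
    sqNorm μ f ≤ 2 * sqNorm μ u + 2 * sqNorm μ v := by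
  have hm : AEMeasurable (fun z => 2 * ‖v z‖ₑ ^ 2) μ := (hv.enorm.pow_const 2).const_mul 2
  rw [sqNorm, sqNorm, sqNorm, ← lintegral_const_mul' _ _ ENNReal.ofNat_ne_top,
    ← lintegral_const_mul' _ _ ENNReal.ofNat_ne_top, ← lintegral_add_right' _ hm]
  refine lintegral_mono_ae (h.mono fun z hz => ?_)
  have h2 : (2 : ℝ≥0∞) = ENNReal.ofReal 2 := by simp
  rw [enorm_sq_eq_ofReal, enorm_sq_eq_ofReal, enorm_sq_eq_ofReal, h2,
    ← ENNReal.ofReal_mul zero_le_two, ← ENNReal.ofReal_mul zero_le_two,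
    ← ENNReal.ofReal_add (by positivity) (by positivity)]
  refine ENNReal.ofReal_le_ofReal ?_
  rw [← sq_abs (f z), ← sq_abs (u z), ← sq_abs (v z)]
  have := abs_nonneg (f z)
  nlinarith [sq_nonneg (|u z| - |v z|)]

end

section

variable {n : ℕ} {ρ h : ℝ} {e x₀ : Space (n + 1)} {K S : Set (Space (n + 1))} {I : Set ℝ}

theorem fderiv_slice {d : ℕ} {φ : SpaceTime d → ℝ} (hφ : Differentiable ℝ φ) (t : ℝ)
    (x η : Space d) : fderiv ℝ (fun y => φ (t, y)) x η = fderiv ℝ φ (t, x) (0, η) := by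
  have h₁ : HasFDerivAt (fun y : Space d => (t, y)) (ContinuousLinearMap.inr ℝ ℝ (Space d)) x :=
    hasFDerivAt_prodMk_right t x
  have h₂ := (hφ (t, x)).hasFDerivAt.comp x h₁
  have h₃ : fderiv ℝ (fun y => φ (t, y)) x
      = (fderiv ℝ φ (t, x)).comp (ContinuousLinearMap.inr ℝ ℝ (Space d)) := h₂.fderiv
  rw [h₃]
  simp

/-- Only spatial derivatives enter: the trace inequality is applied to each time slice and
integrated in time. -/
theorem IsConeBase.sqNorm_surface_le (hS : IsConeBase ρ h e x₀ K S) (hρ : 0 < ρ) (hh : 0 < h)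
    (hK : IsOpen K) (hSm : MeasurableSet S) {φ : SpaceTime (n + 1) → ℝ} (hφ : ContDiff ℝ ∞ φ) :
    sqNorm (surfaceMeasure I S) φ ≤ ENNReal.ofReal (traceConst n ρ) *
      (ENNReal.ofReal h⁻¹ * sqNorm (volume.restrict (I ×ˢ K)) φ + ENNReal.ofReal h *
        ∑ i, sqNorm (volume.restrict (I ×ˢ K)) fun z => fderiv ℝ φ z (dirX i)) := by
  have hfin : IsFiniteMeasure ((Measure.euclideanHausdorffMeasure n).restrict S) :=
    ⟨by rw [Measure.restrict_apply_univ]; exact hS.measure_lt_top hρ hh⟩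
  have hd : Differentiable ℝ φ := hφ.differentiable (by simp)
  have hc : Continuous φ := hφ.continuous
  have hcd : Continuous (fderiv ℝ φ) := hφ.continuous_fderiv (by simp)
  have hG : Measurable fun z : SpaceTime (n + 1) =>
      ENNReal.ofReal (h⁻¹ * φ z ^ 2 + h * ∑ i, fderiv ℝ φ z (dirX i) ^ 2) := by
    refine ENNReal.measurable_ofReal.comp (Continuous.measurable ?_)
    fun_prop
  have hm : Measurable fun z : SpaceTime (n + 1) => ‖φ z‖ₑ ^ 2 := hc.measurable.enorm.pow_const 2
  have hmi : ∀ i, Measurable fun z : SpaceTime (n + 1) => ‖fderiv ℝ φ z (dirX i)‖ₑ ^ 2 := fun i =>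
    (hcd.clm_apply continuous_const).measurable.enorm.pow_const 2
  have hsplit : ∫⁻ z in I ×ˢ K,
      ENNReal.ofReal (h⁻¹ * φ z ^ 2 + h * ∑ i, fderiv ℝ φ z (dirX i) ^ 2)
      = ENNReal.ofReal h⁻¹ * sqNorm (volume.restrict (I ×ˢ K)) φ + ENNReal.ofReal h *
        ∑ i, sqNorm (volume.restrict (I ×ˢ K)) fun z => fderiv ℝ φ z (dirX i) := by
    simp_rw [sqNorm]
    rw [← lintegral_finsetSum _ fun i _ => hmi i, ← lintegral_const_mul _ hm,
      ← lintegral_const_mul _ (Finset.measurable_fun_sum _ fun i _ => hmi i),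
      ← lintegral_add_left (hm.const_mul _)]
    refine lintegral_congr fun z => ?_
    rw [ENNReal.ofReal_add (by positivity) (by positivity), ENNReal.ofReal_mul (by positivity),
      ENNReal.ofReal_mul hh.le, ENNReal.ofReal_sum_of_nonneg fun i _ => sq_nonneg _,
      enorm_sq_eq_ofReal]
    simp_rw [enorm_sq_eq_ofReal]
  rw [← hsplit, Measure.volume_eq_prod, ← Measure.prod_restrict,
    lintegral_prod _ hG.aemeasurable, ← lintegral_const_mul _ hG.lintegral_prod_right']
  change ∫⁻ z, ‖φ z‖ₑ ^ 2 ∂((volume.restrict I).prod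
    ((Measure.euclideanHausdorffMeasure n).restrict S)) ≤ _
  rw [lintegral_prod _ hm.aemeasurable]
  refine lintegral_mono fun t => ?_
  have hv : ContDiff ℝ 1 fun x => φ (t, x) :=
    (hφ.of_le (by exact_mod_cast le_top)).comp (contDiff_const.prodMk contDiff_id)
  refine (hS.lintegral_sq_le hρ hh hK hSm hv).trans_eq ?_
  simp_rw [fderiv_slice hd]
  rfl

/-- The inequality for smooth functions passes to the limit along the sequence that defines the
trace. The factor `4` comes from using `(a + b)² ≤ 2a² + 2b²` twice, on the surface and in the
volume. -/
theorem IsTrace.sqNorm_le (hS : IsConeBase ρ h e x₀ K S) (hρ : 0 < ρ) (hh : 0 < h)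
    (hK : IsOpen K) (hSm : MeasurableSet S) {w g : SpaceTime (n + 1) → ℝ}
    (hw : AEMeasurable w (volume.restrict (I ×ˢ K)))
    (hdw : ∀ i, AEMeasurable (weakDeriv (I ×ˢ K) w (dirX i)) (volume.restrict (I ×ˢ K)))
    (hg : IsTrace I K S w g) :
    sqNorm (surfaceMeasure I S) g ≤ ENNReal.ofReal (4 * traceConst n ρ) *
      (ENNReal.ofReal h⁻¹ * sqNorm (volume.restrict (I ×ˢ K)) w + ENNReal.ofReal h *
        ∑ i, sqNorm (volume.restrict (I ×ˢ K)) (weakDeriv (I ×ˢ K) w (dirX i))) := by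
  obtain ⟨hgm, φ, hφ, hφw, hφd, hφg⟩ := hg
  have hbound : ∀ j, sqNorm (surfaceMeasure I S) g ≤
      2 * sqNorm (surfaceMeasure I S) (fun z => φ j z - g z) +
      2 * (ENNReal.ofReal (traceConst n ρ) * (ENNReal.ofReal h⁻¹ *
        (2 * sqNorm (volume.restrict (I ×ˢ K)) (fun z => φ j z - w z)
          + 2 * sqNorm (volume.restrict (I ×ˢ K)) w)
        + ENNReal.ofReal h * ∑ i, (2 * sqNorm (volume.restrict (I ×ˢ K))
            (fun z => fderiv ℝ (φ j) z (dirX i) - weakDeriv (I ×ˢ K) w (dirX i) z)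
          + 2 * sqNorm (volume.restrict (I ×ˢ K)) (weakDeriv (I ×ˢ K) w (dirX i))))) := by
    intro j
    refine (sqNorm_le_add (u := fun z => φ j z - g z) (v := φ j)
      (hφ j).continuous.measurable.aemeasurable (ae_of_all _ fun z => ?_)).trans ?_
    · have := abs_sub_abs_le_abs_sub (g z) (φ j z)
      rw [abs_sub_comm] at this
      linarith
    gcongr
    refine (hS.sqNorm_surface_le hρ hh hK hSm (hφ j)).trans ?_
    gcongr with i
    · refine sqNorm_le_add hw (ae_of_all _ fun z => ?_)
      have := abs_sub_abs_le_abs_sub (φ j z) (w z)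
      linarith
    · refine sqNorm_le_add (hdw i) (ae_of_all _ fun z => ?_)
      have := abs_sub_abs_le_abs_sub (fderiv ℝ (φ j) z (dirX i)) (weakDeriv (I ×ˢ K) w (dirX i) z)
      linarith
  have hlim := ge_of_tendsto' (f := fun j =>
      2 * sqNorm (surfaceMeasure I S) (fun z => φ j z - g z) +
      2 * (ENNReal.ofReal (traceConst n ρ) * (ENNReal.ofReal h⁻¹ *
        (2 * sqNorm (volume.restrict (I ×ˢ K)) (fun z => φ j z - w z)
          + 2 * sqNorm (volume.restrict (I ×ˢ K)) w)
        + ENNReal.ofReal h * ∑ i, (2 * sqNorm (volume.restrict (I ×ˢ K))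
            (fun z => fderiv ℝ (φ j) z (dirX i) - weakDeriv (I ×ˢ K) w (dirX i) z)
          + 2 * sqNorm (volume.restrict (I ×ˢ K)) (weakDeriv (I ×ˢ K) w (dirX i)))))) (x := atTop)
      (a := 2 * 0 +
      2 * (ENNReal.ofReal (traceConst n ρ) * (ENNReal.ofReal h⁻¹ *
        (2 * 0 + 2 * sqNorm (volume.restrict (I ×ˢ K)) w)
        + ENNReal.ofReal h * ∑ i, (2 * 0
          + 2 * sqNorm (volume.restrict (I ×ˢ K)) (weakDeriv (I ×ˢ K) w (dirX i)))))) ?_ hbound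
  · refine hlim.trans_eq ?_
    rw [ENNReal.ofReal_mul (by norm_num)]
    simp only [mul_zero, zero_add, ← Finset.mul_sum]
    rw [show ENNReal.ofReal 4 = 4 by simp]
    ring
  · have c2 : (2 : ℝ≥0∞) ≠ ⊤ := ENNReal.ofNat_ne_top
    have hr : ∀ a : ℝ, ENNReal.ofReal a ≠ ⊤ := fun _ => ENNReal.ofReal_ne_top
    refine Tendsto.add (ENNReal.Tendsto.const_mul hφg (Or.inr c2)) ?_
    refine ENNReal.Tendsto.const_mul ?_ (Or.inr c2)
    refine ENNReal.Tendsto.const_mul ?_ (Or.inr (hr _))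
    refine Tendsto.add ?_ ?_
    · refine ENNReal.Tendsto.const_mul ?_ (Or.inr (hr _))
      exact (ENNReal.Tendsto.const_mul hφw (Or.inr c2)).add_const _
    · refine ENNReal.Tendsto.const_mul ?_ (Or.inr (hr _))
      refine tendsto_finsetSum _ fun i _ => ?_
      exact (ENNReal.Tendsto.const_mul (hφd i) (Or.inr c2)).add_const _

end

/-! ### Calculus of weak derivatives -/

section

set_option linter.unusedSectionVars false

variable {V : Type} [NormedAddCommGroup V] [NormedSpace ℝ V] [MeasureSpace V]
  {O O' : Set V} {f f₁ f₂ g g₁ g₂ : V → ℝ} {v : V}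

theorem hasWeakDeriv_weakDeriv (h : HasWeakDeriv O f v g) :
    HasWeakDeriv O f v (weakDeriv O f v) := by
  have hex : ∃ g, HasWeakDeriv O f v g := ⟨g, h⟩
  rw [weakDeriv, dif_pos hex]
  exact hex.choose_spec

theorem aemeasurable_weakDeriv [SecondCountableTopology V] (O : Set V) (f : V → ℝ) (v : V) :
    AEMeasurable (weakDeriv O f v) (volume.restrict O) := by
  by_cases hex : ∃ g, HasWeakDeriv O f v g
  · exact (hasWeakDeriv_weakDeriv hex.choose_spec).2.1.aestronglyMeasurable.aemeasurable
  · rw [weakDeriv, dif_neg hex]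
    exact aemeasurable_const

variable [BorelSpace V] [FiniteDimensional ℝ V]

theorem integrableOn_mul_of_hasCompactSupport (hf : LocallyIntegrableOn f O volume)
    {φ : V → ℝ} (hφ : Continuous φ) (hc : HasCompactSupport φ) (hs : tsupport φ ⊆ O) :
    IntegrableOn (fun z => f z * φ z) O volume := by
  have h₁ : IntegrableOn f (tsupport φ) volume := hf.integrableOn_compact_subset hs hc
  have h₂ : IntegrableOn (fun z => f z * φ z) (tsupport φ) volume :=
    h₁.mul_continuousOn hφ.continuousOn hc
  have h₃ : Integrable (fun z => f z * φ z) volume := by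
    refine (integrableOn_iff_integrable_of_support_subset fun z hz => ?_).1 h₂
    exact subset_tsupport φ (right_ne_zero_of_mul hz)
  exact h₃.integrableOn

theorem setIntegral_mul_eq_integral {φ : V → ℝ} (hs : tsupport φ ⊆ O) (f : V → ℝ) :
    ∫ z in O, f z * φ z = ∫ z, f z * φ z :=
  setIntegral_eq_integral_of_forall_compl_eq_zero fun z hz => by
    rw [image_eq_zero_of_notMem_tsupport fun h => hz (hs h), mul_zero]

theorem tsupport_fderiv_apply_subset (φ : V → ℝ) (v : V) :
    tsupport (fun z => fderiv ℝ φ z v) ⊆ tsupport φ := by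
  refine closure_minimal (fun z hz => ?_) (isClosed_tsupport φ)
  refine support_fderiv_subset ℝ fun h => hz ?_
  simp [h]

theorem locallyIntegrableOn_congr_ae (hf : LocallyIntegrableOn f O volume)
    (h : f =ᵐ[volume.restrict O] g) : LocallyIntegrableOn g O volume := by
  intro x hx
  obtain ⟨u, hu, hint⟩ := hf x hx
  refine ⟨u ∩ O, inter_mem hu self_mem_nhdsWithin, ?_⟩
  have : IntegrableOn f (u ∩ O) volume := hint.mono_set inter_subset_left
  exact this.congr (ae_restrict_of_ae_restrict_of_subset inter_subset_right h)

theorem HasWeakDeriv.congr_ae (h : HasWeakDeriv O f₁ v g₁)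
    (hf : f₁ =ᵐ[volume.restrict O] f₂) (hg : g₁ =ᵐ[volume.restrict O] g₂) :
    HasWeakDeriv O f₂ v g₂ := by
  refine ⟨locallyIntegrableOn_congr_ae h.1 hf, locallyIntegrableOn_congr_ae h.2.1 hg,
    fun φ hφ hc hs => ?_⟩
  have h₁ : ∫ z in O, f₂ z * fderiv ℝ φ z v = ∫ z in O, f₁ z * fderiv ℝ φ z v :=
    integral_congr_ae (hf.mono fun z hz => by simp only [hz])
  have h₂ : ∫ z in O, g₂ z * φ z = ∫ z in O, g₁ z * φ z :=
    integral_congr_ae (hg.mono fun z hz => by simp only [hz])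
  rw [h₁, h₂]
  exact h.2.2 φ hφ hc hs

theorem HasWeakDeriv.mono (h : HasWeakDeriv O f v g) (hsub : O' ⊆ O) :
    HasWeakDeriv O' f v g := by
  refine ⟨h.1.mono_set hsub, h.2.1.mono_set hsub, fun φ hφ hc hs => ?_⟩
  have hs' : tsupport (fun z => fderiv ℝ φ z v) ⊆ O' := (tsupport_fderiv_apply_subset φ v).trans hs
  have := h.2.2 φ hφ hc (hs.trans hsub)
  rwa [setIntegral_mul_eq_integral (hs'.trans hsub), setIntegral_mul_eq_integral (hs.trans hsub),
    ← setIntegral_mul_eq_integral hs', ← setIntegral_mul_eq_integral hs] at this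

/-- The difference of the two candidates integrates to zero against every test function, so the
fundamental lemma of the calculus of variations applies. -/
theorem HasWeakDeriv.ae_unique (hO : IsOpen O) (h₁ : HasWeakDeriv O f v g₁)
    (h₂ : HasWeakDeriv O f v g₂) : g₁ =ᵐ[volume.restrict O] g₂ := by
  have key : ∀ᵐ x ∂(volume : Measure V), x ∈ O → (g₁ - g₂) x = 0 := by
    refine hO.ae_eq_zero_of_integral_contDiff_smul_eq_zero (h₁.2.1.sub h₂.2.1)
      fun φ hφ hc hs => ?_
    have e : ∫ x, φ x • (g₁ - g₂) x = ∫ x in O, (g₁ - g₂) x * φ x := by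
      rw [setIntegral_mul_eq_integral hs]
      simp_rw [smul_eq_mul, mul_comm]
    rw [e]
    simp_rw [Pi.sub_apply, sub_mul]
    rw [integral_sub (integrableOn_mul_of_hasCompactSupport h₁.2.1 hφ.continuous hc hs)
      (integrableOn_mul_of_hasCompactSupport h₂.2.1 hφ.continuous hc hs)]
    have e₁ := h₁.2.2 φ hφ hc hs
    have e₂ := h₂.2.2 φ hφ hc hs
    linarith
  refine (ae_restrict_iff' hO.measurableSet).2 (key.mono fun x hx hxO => ?_)
  exact sub_eq_zero.1 (hx hxO)

theorem weakDeriv_ae_eq (hO : IsOpen O) (h : HasWeakDeriv O f v g) :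
    weakDeriv O f v =ᵐ[volume.restrict O] g :=
  (hasWeakDeriv_weakDeriv h).ae_unique hO h

theorem HasWeakDeriv.add (h₁ : HasWeakDeriv O f₁ v g₁)
    (h₂ : HasWeakDeriv O f₂ v g₂) :
    HasWeakDeriv O (fun z => f₁ z + f₂ z) v (fun z => g₁ z + g₂ z) := by
  refine ⟨h₁.1.add h₂.1, h₁.2.1.add h₂.2.1, fun φ hφ hc hs => ?_⟩
  have hφ' : Continuous fun z => fderiv ℝ φ z v :=
    (hφ.continuous_fderiv (by simp)).clm_apply continuous_const
  have hs' := (tsupport_fderiv_apply_subset φ v).trans hs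
  have hc' : HasCompactSupport fun z => fderiv ℝ φ z v :=
    hc.mono' ((subset_tsupport _).trans (tsupport_fderiv_apply_subset φ v))
  simp_rw [add_mul]
  rw [integral_add (integrableOn_mul_of_hasCompactSupport h₁.1 hφ' hc' hs')
      (integrableOn_mul_of_hasCompactSupport h₂.1 hφ' hc' hs'),
    integral_add (integrableOn_mul_of_hasCompactSupport h₁.2.1 hφ.continuous hc hs)
      (integrableOn_mul_of_hasCompactSupport h₂.2.1 hφ.continuous hc hs),
    h₁.2.2 φ hφ hc hs, h₂.2.2 φ hφ hc hs]
  ring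

/-- Outside `O` the product vanishes near each point, whatever the values of `a` there. -/
theorem contDiff_mul_of_tsupport_subset (hO : IsOpen O) {a φ : V → ℝ} (ha : ContDiffOn ℝ ∞ a O)
    (hφ : ContDiff ℝ ∞ φ) (hs : tsupport φ ⊆ O) : ContDiff ℝ ∞ fun z => a z * φ z := by
  refine contDiff_iff_contDiffAt.2 fun z => ?_
  by_cases hz : z ∈ O
  · exact (ha.contDiffAt (hO.mem_nhds hz)).mul hφ.contDiffAt
  · have hz' : (tsupport φ)ᶜ ∈ 𝓝 z :=
      (isClosed_tsupport φ).isOpen_compl.mem_nhds fun h => hz (hs h)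
    refine (contDiffAt_const (c := (0 : ℝ))).congr_of_eventuallyEq ?_
    filter_upwards [hz'] with y hy
    rw [image_eq_zero_of_notMem_tsupport hy, mul_zero]

/-- If `φ` is a test function on `O`, so is `aφ`; testing with it and expanding its derivative gives
the product rule. No bound on `a` up to the boundary is needed. -/
theorem HasWeakDeriv.smooth_mul (hO : IsOpen O) {a : V → ℝ} (ha : ContDiffOn ℝ ∞ a O)
    (h : HasWeakDeriv O f v g) :
    HasWeakDeriv O (fun z => a z * f z) v (fun z => a z * g z + fderiv ℝ a z v * f z) := by
  have hda : ContinuousOn (fun z => fderiv ℝ a z v) O :=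
    (ha.continuousOn_fderiv_of_isOpen hO (by simp)).clm_apply continuousOn_const
  have hL₁ : LocallyIntegrableOn (fun z => a z * f z) O volume :=
    h.1.continuousOn_mul ha.continuousOn hO.isLocallyClosed
  have hL₂ : LocallyIntegrableOn (fun z => a z * g z) O volume :=
    h.2.1.continuousOn_mul ha.continuousOn hO.isLocallyClosed
  have hL₃ : LocallyIntegrableOn (fun z => fderiv ℝ a z v * f z) O volume :=
    h.1.continuousOn_mul hda hO.isLocallyClosed
  refine ⟨hL₁, hL₂.add hL₃, fun φ hφ hc hs => ?_⟩
  set ψ : V → ℝ := fun z => a z * φ z with hψ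
  have hψs : tsupport ψ ⊆ tsupport φ :=
    closure_mono fun z hz => right_ne_zero_of_mul hz
  have hψc : HasCompactSupport ψ := hc.mono' ((subset_tsupport _).trans hψs)
  have hψd := contDiff_mul_of_tsupport_subset hO ha hφ hs
  have key := h.2.2 ψ hψd hψc (hψs.trans hs)
  have hψ' : Continuous fun z => fderiv ℝ ψ z v :=
    (hψd.continuous_fderiv (by simp)).clm_apply continuous_const
  have hψc' : HasCompactSupport fun z => fderiv ℝ ψ z v :=
    hψc.mono' ((subset_tsupport _).trans (tsupport_fderiv_apply_subset ψ v))
  have hψs' := (tsupport_fderiv_apply_subset ψ v).trans (hψs.trans hs)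
  have hprod : ∀ z ∈ O, fderiv ℝ ψ z v = a z * fderiv ℝ φ z v + fderiv ℝ a z v * φ z := by
    intro z hz
    have h₁ : DifferentiableAt ℝ a z :=
      ((ha.contDiffAt (hO.mem_nhds hz)).differentiableAt (by simp))
    have h₂ : DifferentiableAt ℝ φ z := hφ.differentiable (by simp) z
    rw [hψ, fderiv_fun_mul h₁ h₂]
    simp
    ring
  have e₁ : ∫ z in O, a z * f z * fderiv ℝ φ z v
      = ∫ z in O, (f z * fderiv ℝ ψ z v - fderiv ℝ a z v * f z * φ z) :=
    setIntegral_congr_fun hO.measurableSet fun z hz => by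
      simp only [hprod z hz]; ring
  have e₂ : ∫ z in O, g z * ψ z = ∫ z in O, a z * g z * φ z := by
    congr 1; funext z; simp only [hψ]; ring
  rw [e₁, integral_sub (integrableOn_mul_of_hasCompactSupport h.1 hψ' hψc' hψs')
    (integrableOn_mul_of_hasCompactSupport hL₃ hφ.continuous hc hs), key, e₂]
  simp_rw [add_mul]
  rw [integral_add (integrableOn_mul_of_hasCompactSupport hL₂ hφ.continuous hc hs)
    (integrableOn_mul_of_hasCompactSupport hL₃ hφ.continuous hc hs)]
  ring

end

/-! ### Bounds for the coefficient and for the derivatives of the flux -/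

/-- Smoothness on the closed set provides, near each of its points, a Taylor series with
coefficients continuous up to the boundary. On the open set `W` these are the true derivatives, so
local boundedness and compactness suffice, without any regularity of the boundary of `W`. -/
theorem exists_norm_iteratedFDeriv_le {d : ℕ} {W : Set (Space d)} (hW : IsOpen W)
    (hWb : Bornology.IsBounded W) {G : Space d → ℝ} (hG : ContDiffOn ℝ ∞ G (closure W)) (m : ℕ) :
    ∃ B, ∀ x ∈ W, ‖iteratedFDeriv ℝ m G x‖ ≤ B := by
  have hc : IsCompact (closure W) := hWb.isCompact_closure
  suffices h : ∃ B, ∀ x ∈ closure W ∩ W, ‖iteratedFDeriv ℝ m G x‖ ≤ B by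
    obtain ⟨B, hB⟩ := h
    exact ⟨B, fun x hx => hB x ⟨subset_closure hx, hx⟩⟩
  refine hc.induction_on (p := fun s => ∃ B, ∀ x ∈ s ∩ W, ‖iteratedFDeriv ℝ m G x‖ ≤ B)
    ⟨0, by simp⟩ ?_ ?_ ?_
  · rintro s t hst ⟨B, hB⟩
    exact ⟨B, fun x hx => hB x ⟨hst hx.1, hx.2⟩⟩
  · rintro s t ⟨B, hB⟩ ⟨B', hB'⟩
    refine ⟨max B B', fun x hx => ?_⟩
    rcases hx.1 with h | h
    · exact (hB x ⟨h, hx.2⟩).trans (le_max_left _ _)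
    · exact (hB' x ⟨h, hx.2⟩).trans (le_max_right _ _)
  · intro x hx
    have hm : ContDiffWithinAt ℝ (m : ℕ) G (closure W) x :=
      (hG x hx).of_le (by exact_mod_cast le_top)
    obtain ⟨u, hu, p, hp⟩ := contDiffWithinAt_nat.1 hm
    rw [insert_eq_of_mem hx] at hu
    have hxu : x ∈ u := mem_of_mem_nhdsWithin hx hu
    have hcont : ContinuousWithinAt (fun y => p y m) u x := hp.cont m le_rfl x hxu
    have hev : ∀ᶠ y in 𝓝[closure W] x, ‖p y m‖ < ‖p x m‖ + 1 :=
      (hcont.norm.eventually_lt continuousWithinAt_const (lt_add_one _)).filter_mono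
        (nhdsWithin_le_iff.2 hu)
    obtain ⟨o, ho, hxo, hou⟩ := mem_nhdsWithin.1 hu
    refine ⟨{y | ‖p y m‖ < ‖p x m‖ + 1} ∩ o, inter_mem hev
      (mem_nhdsWithin_of_mem_nhds (ho.mem_nhds hxo)), ‖p x m‖ + 1, ?_⟩
    rintro y ⟨⟨hy, hyo⟩, hyW⟩
    have hoW : IsOpen (o ∩ W) := ho.inter hW
    have hsub : o ∩ W ⊆ u := fun z hz => hou ⟨hz.1, subset_closure hz.2⟩
    have e₁ := (hp.mono hsub).eq_iteratedFDerivWithin_of_uniqueDiffOn le_rfl hoW.uniqueDiffOn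
      ⟨hyo, hyW⟩
    rw [iteratedFDerivWithin_of_isOpen m hoW ⟨hyo, hyW⟩] at e₁
    rw [← e₁]
    exact le_of_lt hy

/-- The first and second partial derivatives of `G` are bounded by `B` on `K`. -/
def HasPartialBounds {d : ℕ} (G : Space d → ℝ) (B : ℝ) (K : Set (Space d)) : Prop :=
  ∀ x ∈ K, ∀ i : Fin d, |fderiv ℝ G x (EuclideanSpace.single i 1)| ≤ B ∧
    ∀ l : Fin d, |fderiv ℝ (fun y => fderiv ℝ G y (EuclideanSpace.single i 1)) x
      (EuclideanSpace.single l 1)| ≤ B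

theorem norm_single_one {d : ℕ} (i : Fin d) : ‖(EuclideanSpace.single i 1 : Space d)‖ = 1 := by
  simp

theorem exists_hasPartialBounds {d : ℕ} {W : Set (Space d)} (hW : IsOpen W)
    (hWb : Bornology.IsBounded W) {G : Space d → ℝ} (hG : ContDiffOn ℝ ∞ G (closure W)) :
    ∃ B, 0 ≤ B ∧ HasPartialBounds G B W := by
  obtain ⟨B₁, h₁⟩ := exists_norm_iteratedFDeriv_le hW hWb hG 1
  obtain ⟨B₂, h₂⟩ := exists_norm_iteratedFDeriv_le hW hWb hG 2
  refine ⟨max 0 (max B₁ B₂), le_max_left _ _, fun x hx i => ⟨?_, fun l => ?_⟩⟩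
  · have := h₁ x hx
    rw [← norm_iteratedFDeriv_fderiv, norm_iteratedFDeriv_zero] at this
    refine ((fderiv ℝ G x).le_opNorm _).trans ?_
    rw [norm_single_one, mul_one]
    exact this.trans ((le_max_left _ _).trans (le_max_right _ _))
  · have := h₂ x hx
    rw [← norm_iteratedFDeriv_fderiv, ← norm_iteratedFDeriv_fderiv,
      norm_iteratedFDeriv_zero] at this
    have hd : DifferentiableAt ℝ (fderiv ℝ G) x := by
      have : ContDiffAt ℝ (2 : ℕ) G x :=
        contDiffAt_infty.1 ((hG.mono subset_closure).contDiffAt (hW.mem_nhds hx)) 2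
      exact (this.fderiv_right (m := 1) (by norm_num)).differentiableAt one_ne_zero
    have e : fderiv ℝ (fun y => fderiv ℝ G y (EuclideanSpace.single i 1)) x
        (EuclideanSpace.single l 1)
        = fderiv ℝ (fderiv ℝ G) x (EuclideanSpace.single l 1) (EuclideanSpace.single i 1) := by
      rw [fderiv_clm_apply hd (differentiableAt_const _)]
      simp
    rw [e, ← Real.norm_eq_abs]
    refine (ContinuousLinearMap.le_opNorm _ _).trans ?_
    rw [norm_single_one, mul_one]
    refine (ContinuousLinearMap.le_opNorm _ _).trans ?_
    rw [norm_single_one, mul_one]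
    exact this.trans ((le_max_right _ _).trans (le_max_right _ _))

theorem fderiv_comp_snd_dirX {d : ℕ} {A : Space d → ℝ} {z : SpaceTime d}
    (hA : DifferentiableAt ℝ A z.2) (l : Fin d) :
    fderiv ℝ (fun z : SpaceTime d => A z.2) z (dirX l)
      = fderiv ℝ A z.2 (EuclideanSpace.single l 1) := by
  have h : HasFDerivAt (fun z : SpaceTime d => A z.2)
      ((fderiv ℝ A z.2).comp (ContinuousLinearMap.snd ℝ ℝ (Space d))) z :=
    hA.hasFDerivAt.comp z hasFDerivAt_snd
  rw [h.fderiv]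
  simp [dirX]

/-- With `a = exp G` and `w = au`, the flux is `a pᵢ = ∂ᵢw + γw` where `γ = -∂ᵢG`. Hence its `l`-th
derivative is `∂ₗ∂ᵢw + γ∂ₗw + (∂ₗγ)w`, which involves only `w` and bounded coefficients. The
exponential form makes `γ` free of quotients. -/
theorem sqNorm_weakDeriv_exp_mul_le {d : ℕ} {I : Set ℝ} {K : Set (Space d)} (hI : IsOpen I)
    (hK : IsOpen K) {G : Space d → ℝ} (hG : ContDiffOn ℝ ∞ G K) {B : ℝ} (hB0 : 0 ≤ B)
    (hB : HasPartialBounds G B K) {u : SpaceTime d → ℝ} {p : Fin d → SpaceTime d → ℝ}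
    {q : Fin d → Fin d → SpaceTime d → ℝ} (hp : ∀ i, HasWeakDeriv (I ×ˢ K) u (dirX i) (p i))
    (hq : ∀ i l, HasWeakDeriv (I ×ˢ K) (p i) (dirX l) (q i l)) (i l : Fin d) :
    sqNorm (volume.restrict (I ×ˢ K))
        (weakDeriv (I ×ˢ K) (fun z => Real.exp (G z.2) * p i z) (dirX l))
      ≤ ENNReal.ofReal (2 + 4 * B ^ 2) *
        sqNormL2H2 I K (fun z => Real.exp (G z.2) * u z) := by
  set O : Set (SpaceTime d) := I ×ˢ K with hOdef
  have hO : IsOpen O := hI.prod hK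
  have hmaps : MapsTo (Prod.snd : SpaceTime d → Space d) O K := fun z hz => hz.2
  have hGd : ∀ z ∈ O, DifferentiableAt ℝ G z.2 := fun z hz =>
    (hG.contDiffAt (hK.mem_nhds hz.2)).differentiableAt (by simp)
  set a : SpaceTime d → ℝ := fun z => Real.exp (G z.2) with ha
  have haS : ContDiffOn ℝ ∞ a O :=
    (hG.comp contDiff_snd.contDiffOn hmaps).exp
  have haD : ∀ i, ∀ z ∈ O, fderiv ℝ a z (dirX i)
      = a z * fderiv ℝ G z.2 (EuclideanSpace.single i 1) := by
    intro i z hz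
    have h₁ := fderiv_comp_snd_dirX (A := fun y => Real.exp (G y)) (hGd z hz).exp i
    rw [ha, h₁, fderiv_exp (hGd z hz)]
    simp
  have haDS : ∀ i : Fin d, ContDiffOn ℝ ∞ (fun z => fderiv ℝ a z (dirX i)) O := fun i =>
    (haS.fderiv_of_isOpen hO (by simp)).clm_apply contDiffOn_const
  set γ : SpaceTime d → ℝ := fun z => -fderiv ℝ G z.2 (EuclideanSpace.single i 1) with hγ
  have hGi : ContDiffOn ℝ ∞ (fun y => fderiv ℝ G y (EuclideanSpace.single i 1)) K :=
    (hG.fderiv_of_isOpen hK (by simp)).clm_apply contDiffOn_const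
  have hγS : ContDiffOn ℝ ∞ γ O := (hGi.comp contDiff_snd.contDiffOn hmaps).neg
  have hγD : ∀ z ∈ O, |fderiv ℝ γ z (dirX l)| ≤ B := by
    intro z hz
    have hd : DifferentiableAt ℝ (fun y => fderiv ℝ G y (EuclideanSpace.single i 1)) z.2 :=
      (hGi.contDiffAt (hK.mem_nhds hz.2)).differentiableAt (by simp)
    have h₁ := fderiv_comp_snd_dirX hd.fun_neg l
    rw [hγ, h₁, fderiv_fun_neg]
    simpa using (hB z.2 hz.2 i).2 l
  set w : SpaceTime d → ℝ := fun z => a z * u z with hw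
  have hwi : ∀ i, HasWeakDeriv O w (dirX i)
      (fun z => a z * p i z + fderiv ℝ a z (dirX i) * u z) := fun i => (hp i).smooth_mul hO haS
  have hwi' : HasWeakDeriv O (weakDeriv O w (dirX i)) (dirX l)
      (weakDeriv O (weakDeriv O w (dirX i)) (dirX l)) := by
    -- The second weak derivative of `w` exists by the product rule applied to both terms of its
    -- first derivative.
    have h₁ := ((hq i l).smooth_mul hO haS).add ((hp l).smooth_mul hO (haDS i))
    exact hasWeakDeriv_weakDeriv (h₁.congr_ae (weakDeriv_ae_eq hO (hwi i)).symm (ae_eq_refl _))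
  have hflux : HasWeakDeriv O (fun z => a z * p i z) (dirX l)
      (fun z => weakDeriv O (weakDeriv O w (dirX i)) (dirX l) z
        + (γ z * weakDeriv O w (dirX l) z + fderiv ℝ γ z (dirX l) * w z)) := by
    refine (hwi'.add ((hasWeakDeriv_weakDeriv (hwi l)).smooth_mul hO hγS)).congr_ae ?_
      (ae_eq_refl _)
    filter_upwards [weakDeriv_ae_eq hO (hwi i), ae_restrict_mem hO.measurableSet] with z hz hzO
    rw [hz, haD i z hzO, hγ, hw]
    ring
  have hwm : AEMeasurable w (volume.restrict O) := (hwi i).1.aestronglyMeasurable.aemeasurable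
  have hwlm : AEMeasurable (weakDeriv O w (dirX l)) (volume.restrict O) :=
    aemeasurable_weakDeriv _ _ _
  have hle : sqNorm (volume.restrict O) (weakDeriv O (fun z => a z * p i z) (dirX l))
      ≤ 2 * sqNorm (volume.restrict O) (weakDeriv O (weakDeriv O w (dirX i)) (dirX l))
        + 2 * sqNorm (volume.restrict O) (fun z => |B * weakDeriv O w (dirX l) z| + |B * w z|) := by
    refine sqNorm_le_add ((hwlm.const_mul B).norm.add (hwm.const_mul B).norm) ?_
    filter_upwards [weakDeriv_ae_eq hO hflux, ae_restrict_mem hO.measurableSet] with z hz hzO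
    rw [hz, abs_of_nonneg (by positivity : 0 ≤ |B * weakDeriv O w (dirX l) z| + |B * w z|)]
    refine (abs_add_le _ _).trans (add_le_add_right ((abs_add_le _ _).trans ?_) _)
    rw [abs_mul (γ z), abs_mul (fderiv ℝ γ z (dirX l)), abs_mul B, abs_mul B, abs_of_nonneg hB0]
    have h₁ : |γ z| ≤ B := by
      rw [hγ, abs_neg]
      exact (hB z.2 hzO.2 i).1
    have h₂ := hγD z hzO
    gcongr
  have hle' : sqNorm (volume.restrict O) (fun z => |B * weakDeriv O w (dirX l) z| + |B * w z|)
      ≤ 2 * (ENNReal.ofReal (B ^ 2) * sqNorm (volume.restrict O) (weakDeriv O w (dirX l)))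
        + 2 * (ENNReal.ofReal (B ^ 2) * sqNorm (volume.restrict O) w) := by
    rw [← sqNorm_const_mul, ← sqNorm_const_mul]
    refine sqNorm_le_add (hwm.const_mul B) (ae_of_all _ fun z => ?_)
    rw [abs_of_nonneg (by positivity)]
  rw [sqNormL2H2]
  set s₀ := sqNorm (volume.restrict O) w
  have h₁ : sqNorm (volume.restrict O) (weakDeriv O w (dirX l))
      ≤ ∑ i, sqNorm (volume.restrict O) (weakDeriv O w (dirX i)) :=
    Finset.single_le_sum (f := fun i => sqNorm (volume.restrict O) (weakDeriv O w (dirX i)))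
      (fun _ _ => zero_le) (Finset.mem_univ l)
  have h₂ : sqNorm (volume.restrict O) (weakDeriv O (weakDeriv O w (dirX i)) (dirX l))
      ≤ ∑ i, ∑ j, sqNorm (volume.restrict O) (weakDeriv O (weakDeriv O w (dirX i)) (dirX j)) := by
    refine le_trans ?_ (Finset.single_le_sum (f := fun i => ∑ j, sqNorm (volume.restrict O)
      (weakDeriv O (weakDeriv O w (dirX i)) (dirX j))) (fun _ _ => zero_le) (Finset.mem_univ i))
    exact Finset.single_le_sum (f := fun j => sqNorm (volume.restrict O)
      (weakDeriv O (weakDeriv O w (dirX i)) (dirX j))) (fun _ _ => zero_le) (Finset.mem_univ l)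
  set s₁ := ∑ i, sqNorm (volume.restrict O) (weakDeriv O w (dirX i))
  set s₂ := ∑ i, ∑ j, sqNorm (volume.restrict O) (weakDeriv O (weakDeriv O w (dirX i)) (dirX j))
  have hC : ENNReal.ofReal (2 + 4 * B ^ 2) = 2 + 4 * ENNReal.ofReal (B ^ 2) := by
    rw [ENNReal.ofReal_add (by norm_num) (by positivity), ENNReal.ofReal_mul (by norm_num)]
    norm_num
  calc _ ≤ 2 * s₂ + 2 * (2 * (ENNReal.ofReal (B ^ 2) * s₁) + 2 * (ENNReal.ofReal (B ^ 2) * s₀)) := by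
        refine hle.trans ?_
        gcongr
        refine hle'.trans ?_
        gcongr
    _ ≤ 2 * s₂ + 2 * (2 * (ENNReal.ofReal (B ^ 2) * s₁) + 2 * (ENNReal.ofReal (B ^ 2) * s₀))
        + (2 * (s₀ + s₁) + 4 * ENNReal.ofReal (B ^ 2) * s₂) := le_self_add
    _ = ENNReal.ofReal (2 + 4 * B ^ 2) * (s₀ + s₁ + s₂) := by rw [hC]; ring

/-! ### The wave speed on the cells -/

section

variable {d : ℕ} {M : Medium d} {D : Discretization d} {ρ : ℝ}

theorem Medium.Ω₁_subset (M : Medium d) : M.Ω₁ ⊆ M.Ω := fun _ hx =>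
  (M.diff_Γ.ge (Or.inl hx)).1

theorem Medium.Ω₂_subset (M : Medium d) : M.Ω₂ ⊆ M.Ω := fun _ hx =>
  (M.diff_Γ.ge (Or.inr hx)).1

theorem exists_coefficient_bounds {W : Set (Space d)} (hW : IsOpen W)
    (hWb : Bornology.IsBounded W) {c : Space d → ℝ} (hc : ContDiffOn ℝ ∞ c (closure W))
    (hpos : ∀ x ∈ closure W, 0 < c x) :
    ∃ b > 0, ∃ B ≥ 0, (∀ x ∈ W, b ≤ c x) ∧ HasPartialBounds (fun x => Real.log (c x ^ 2)) B W := by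
  have hlog : ContDiffOn ℝ ∞ (fun x => Real.log (c x ^ 2)) (closure W) :=
    (hc.pow 2).log fun x hx => pow_ne_zero 2 (hpos x hx).ne'
  obtain ⟨B, hB0, hB⟩ := exists_hasPartialBounds hW hWb hlog
  rcases (closure W).eq_empty_or_nonempty with he | hne
  · exact ⟨1, one_pos, B, hB0, fun x hx => absurd (subset_closure hx) (by simp [he]), hB⟩
  · obtain ⟨y, hy, hmin⟩ := hWb.isCompact_closure.exists_isMinOn hne hc.continuousOn
    exact ⟨c y, hpos y hy, B, hB0, fun x hx => hmin (subset_closure hx), hB⟩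

/-- On `K` the wave speed is at least `b`, and its square is the exponential of a smooth function
with partial derivatives bounded by `B`. -/
structure IsSmoothSpeed (M : Medium d) (b B : ℝ) (K : Set (Space d)) : Prop where
  le_c : ∀ x ∈ K, b ≤ M.c x
  continuousOn_c : ContinuousOn M.c K
  exists_exp : ∃ G : Space d → ℝ, ContDiffOn ℝ ∞ G K ∧ HasPartialBounds G B K ∧
    ∀ x ∈ K, M.c x ^ 2 = Real.exp (G x)

theorem isSmoothSpeed_of_eqOn {W K : Set (Space d)} (hKW : K ⊆ W) {c : Space d → ℝ}
    (hc : ContDiffOn ℝ ∞ c (closure W)) (hpos : ∀ x ∈ closure W, 0 < c x)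
    (heq : ∀ x ∈ W, M.c x = c x) {b b' B B' : ℝ} (hb : ∀ x ∈ W, b' ≤ c x)
    (hB : HasPartialBounds (fun x => Real.log (c x ^ 2)) B' W) (hbb : b ≤ b') (hBB : B' ≤ B) :
    IsSmoothSpeed M b B K := by
  have hKc : K ⊆ closure W := hKW.trans subset_closure
  refine ⟨fun x hx => (hbb.trans (hb x (hKW hx))).trans_eq (heq x (hKW hx)).symm,
    (hc.continuousOn.mono hKc).congr fun x hx => heq x (hKW hx),
    fun x => Real.log (c x ^ 2),
    ((hc.mono hKc).pow 2).log fun x hx => pow_ne_zero 2 (hpos x (hKc hx)).ne',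
    fun x hx i => ⟨((hB x (hKW hx) i).1).trans hBB, fun l => ((hB x (hKW hx) i).2 l).trans hBB⟩,
    fun x hx => ?_⟩
  rw [Real.exp_log (pow_pos (hpos x (hKc hx)) 2), heq x (hKW hx)]

/-- The bounds are obtained on `Ω₁` and `Ω₂` once and inherited by subsets; this makes them
independent of the mesh. -/
theorem Medium.exists_isSmoothSpeed (M : Medium d) :
    ∃ b > 0, ∃ B ≥ 0, ∀ K, K ⊆ M.Ω₁ ∨ K ⊆ M.Ω₂ → IsSmoothSpeed M b B K := by
  obtain ⟨b₁, hb₁, B₁, hB₁, hc₁, hp₁⟩ := exists_coefficient_bounds M.isOpen_Ω₁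
    (M.isBounded_Ω.subset M.Ω₁_subset) M.smooth_c₁ M.pos_c₁
  obtain ⟨b₂, hb₂, B₂, hB₂, hc₂, hp₂⟩ := exists_coefficient_bounds M.isOpen_Ω₂
    (M.isBounded_Ω.subset M.Ω₂_subset) M.smooth_c₂ M.pos_c₂
  refine ⟨min b₁ b₂, lt_min hb₁ hb₂, max B₁ B₂, hB₁.trans (le_max_left _ _), ?_⟩
  rintro K (hK | hK)
  · exact isSmoothSpeed_of_eqOn hK M.smooth_c₁ M.pos_c₁ (fun x hx => if_pos hx) hc₁ hp₁
      (min_le_left _ _) (le_max_left _ _)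
  · exact isSmoothSpeed_of_eqOn hK M.smooth_c₂ M.pos_c₂
      (fun x hx => if_neg (Set.disjoint_right.1 M.disjoint_Ω₁_Ω₂ hx)) hc₂ hp₂
      (min_le_right _ _) (le_max_right _ _)

theorem isOpen_slabTime (n : ℕ) : IsOpen (slabTime M D n) := isOpen_Ioo

theorem restrict_slab (n : ℕ) : (volume : Measure (SpaceTime d)).restrict (slab M D n)
    = (volume.restrict (slabTime M D n)).prod (volume.restrict M.Ω) := by
  rw [slab, Measure.volume_eq_prod, Measure.prod_restrict]

theorem ae_slab_of_ae {P : Space d → Prop} (h : ∀ᵐ x ∂volume.restrict M.Ω, P x) (n : ℕ) :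
    ∀ᵐ z ∂volume.restrict (slab M D n), P z.2 := by
  rw [restrict_slab]
  exact Measure.quasiMeasurePreserving_snd.ae h

theorem aemeasurable_comp_snd_slab {f : Space d → ℝ} (hf : AEMeasurable f (volume.restrict M.Ω))
    (n : ℕ) : AEMeasurable (fun z : SpaceTime d => f z.2) (volume.restrict (slab M D n)) := by
  rw [restrict_slab]
  exact hf.comp_quasiMeasurePreserving Measure.quasiMeasurePreserving_snd

/-- The speed is continuous on each of finitely many open cells, and these exhaust `Ω` up to a null
set. -/
theorem Admissible.aemeasurable_c (hD : Admissible M D ρ) {b B : ℝ}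
    (hc : ∀ s ∈ simplices M D, IsSmoothSpeed M b B (cell M s)) :
    AEMeasurable M.c (volume.restrict M.Ω) := by
  have : Countable (simplices M D) := hD.finite_simplices.countable
  have h₁ : AEMeasurable M.c (volume.restrict (⋃ s : simplices M D, cell M s)) :=
    aemeasurable_iUnion_iff.2 fun s =>
      (hc s s.2).continuousOn_c.aemeasurable (isOpen_cell _).measurableSet
  have h₂ : ∀ᵐ x ∂volume.restrict M.Ω, x ∈ ⋃ s : simplices M D, cell M s :=
    hD.ae_mem_cell.mono fun x ⟨s, hs, hx⟩ => mem_iUnion.2 ⟨⟨s, hs⟩, hx⟩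
  rw [← Measure.restrict_eq_self_of_ae_mem h₂]
  exact h₁.mono_measure (Measure.restrict_mono_measure Measure.restrict_le_self _)

theorem Admissible.aemeasurable_flux (hD : Admissible M D ρ) {b B : ℝ}
    (hc : ∀ s ∈ simplices M D, IsSmoothSpeed M b B (cell M s)) (n : ℕ) (i : Fin d)
    (u : SpaceTime d → ℝ) :
    AEMeasurable (flux M D n i u) (volume.restrict (slab M D n)) :=
  ((aemeasurable_comp_snd_slab (hD.aemeasurable_c hc) n).pow_const 2).mul
    (aemeasurable_weakDeriv _ _ _)

theorem MemFullyDiscrete.aemeasurable {k q : ℕ} {y : SpaceTime d → ℝ}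
    (hy : MemFullyDiscrete M D k q y) {n : ℕ} (hn : n < D.N) :
    AEMeasurable y (volume.restrict (slab M D n)) := by
  obtain ⟨v, hv, hyv⟩ := hy n hn
  have : AEMeasurable (fun z : SpaceTime d => ∑ j : Fin (q + 1), z.1 ^ (j : ℕ) * v j z.2)
      (volume.restrict (slab M D n)) :=
    Finset.aemeasurable_fun_sum _ fun j _ =>
      (measurable_fst.pow_const _).aemeasurable.mul
        (aemeasurable_comp_snd_slab (hv j).1.1.1.aemeasurable n)
  exact this.congr (EventuallyEq.symm hyv)

/-! ### The flux on a cell -/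

/-- Equality is exact and not merely almost everywhere: both functions define the same predicate,
hence the same choice. -/
theorem weakDeriv_congr_ae {V : Type} [NormedAddCommGroup V] [NormedSpace ℝ V] [MeasureSpace V]
    [BorelSpace V] [FiniteDimensional ℝ V] {O : Set V} {f₁ f₂ : V → ℝ}
    (h : f₁ =ᵐ[volume.restrict O] f₂) (v : V) : weakDeriv O f₁ v = weakDeriv O f₂ v := by
  have : HasWeakDeriv O f₁ v = HasWeakDeriv O f₂ v := funext fun g => propext
    ⟨fun hg => hg.congr_ae h (ae_eq_refl g), fun hg => hg.congr_ae h.symm (ae_eq_refl g)⟩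
  unfold weakDeriv
  rw [this]

theorem sqNormL2H2_congr_ae {I : Set ℝ} {K : Set (Space d)} {f₁ f₂ : SpaceTime d → ℝ}
    (h : f₁ =ᵐ[volume.restrict (I ×ˢ K)] f₂) : sqNormL2H2 I K f₁ = sqNormL2H2 I K f₂ := by
  have h₁ : sqNorm (volume.restrict (I ×ˢ K)) f₁ = sqNorm (volume.restrict (I ×ˢ K)) f₂ :=
    lintegral_congr_ae (h.mono fun z hz => by simp only [hz])
  simp only [sqNormL2H2, weakDeriv_congr_ae h, h₁]

theorem cell_subset (s : Finset (Space d)) : cell M s ⊆ M.Ω := inter_subset_right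

theorem IsRegular.sqNorm_weakDeriv_flux_le {U : (SpaceTime d → ℝ) × (SpaceTime d → ℝ)}
    (hU : IsRegular M D U) {n : ℕ} (hn : n < D.N) {s : Finset (Space d)} (hs : s ∈ simplices M D)
    {b B : ℝ} (hB : 0 ≤ B) (hc : IsSmoothSpeed M b B (cell M s)) (i l : Fin d) :
    sqNorm (volume.restrict (slabTime M D n ×ˢ cell M s))
        (weakDeriv (slabTime M D n ×ˢ cell M s) (flux M D n i U.1) (dirX l))
      ≤ ENNReal.ofReal (2 + 4 * B ^ 2) *
        sqNormL2H2 (slabTime M D n) (cell M s) (fun z => M.c z.2 ^ 2 * U.1 z) := by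
  obtain ⟨hH1, hH2, -⟩ := hU n hn
  obtain ⟨G, hG, hGB, hcG⟩ := hc.exists_exp
  have hO : IsOpen (slabTime M D n ×ˢ cell M s) := (isOpen_slabTime n).prod (isOpen_cell s)
  have hp : ∀ i, HasWeakDeriv (slabTime M D n ×ˢ cell M s) U.1 (dirX i)
      (spaceDeriv M D n i U.1) := fun i => by
    obtain ⟨g, -, hg⟩ := hH1.2 (dirX i)
    exact (hasWeakDeriv_weakDeriv hg).mono (prod_mono_right (cell_subset s))
  have hq : ∀ i l, ∃ q, HasWeakDeriv (slabTime M D n ×ˢ cell M s) (spaceDeriv M D n i U.1)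
      (dirX l) q := fun i l => by
    obtain ⟨g, -, hg, hg₂⟩ := (hH2 s hs).2 i
    obtain ⟨g', -, hg'⟩ := hg₂ l
    -- The cellwise first derivative from the `H²` regularity agrees with the restriction of the
    -- slab derivative by uniqueness, so it may be replaced under the second derivative.
    exact ⟨g', hg'.congr_ae (hg.ae_unique hO (hp i)) (ae_eq_refl _)⟩
  choose q hq using hq
  have hmem := ae_restrict_mem (μ := (volume : Measure (SpaceTime d))) hO.measurableSet
  have e₁ : flux M D n i U.1 =ᵐ[volume.restrict (slabTime M D n ×ˢ cell M s)]
      fun z => Real.exp (G z.2) * spaceDeriv M D n i U.1 z :=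
    hmem.mono fun z hz => by rw [flux, hcG z.2 hz.2]
  have e₂ : (fun z => M.c z.2 ^ 2 * U.1 z) =ᵐ[volume.restrict (slabTime M D n ×ˢ cell M s)]
      fun z => Real.exp (G z.2) * U.1 z :=
    hmem.mono fun z hz => by simp only [hcG z.2 hz.2]
  rw [weakDeriv_congr_ae e₁, sqNormL2H2_congr_ae e₂]
  exact sqNorm_weakDeriv_exp_mul_le (isOpen_slabTime n) (isOpen_cell s) hG hB hGB hp hq i l

end

/-! ### The lateral boundary -/

section

variable {n : ℕ} {M : Medium (n + 1)} {D : Discretization (n + 1)} {ρ : ℝ}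

/-- Every cell is a cone over its piece of the boundary of `Ω`. -/
def HasConicalCells (M : Medium (n + 1)) (D : Discretization (n + 1)) (ρ : ℝ) : Prop :=
  ∀ s ∈ simplices M D, ∃ e x₀,
    IsConeBase ρ D.h e x₀ (cell M s) (frontier M.Ω ∩ closure (cell M s))

theorem measurableSet_cellBoundary (s : Finset (Space (n + 1))) :
    MeasurableSet (frontier M.Ω ∩ closure (cell M s)) :=
  (isClosed_frontier.inter isClosed_closure).measurableSet

theorem Admissible.frontier_eq (hD : Admissible M D ρ) (hρ : 0 < ρ) :
    frontier M.Ω = ⋃ s : simplices M D, frontier M.Ω ∩ closure (cell M s) := by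
  refine subset_antisymm ?_ (iUnion_subset fun s => inter_subset_left)
  have := hD.frontier_subset hρ
  rwa [biUnion_eq_iUnion] at this

theorem Admissible.measure_frontier_lt_top (hD : Admissible M D ρ) (hρ : 0 < ρ)
    (hcone : HasConicalCells M D ρ) :
    Measure.euclideanHausdorffMeasure n (frontier M.Ω) < ⊤ := by
  refine (measure_mono (hD.frontier_subset hρ)).trans_lt
    (measure_biUnion_lt_top hD.finite_simplices fun s hs => ?_)
  obtain ⟨e, x₀, h⟩ := hcone s hs
  exact h.measure_lt_top hρ hD.pos_h

theorem Admissible.surfaceMeasure_cell_eq (hD : Admissible M D ρ) (hρ : 0 < ρ)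
    (hcone : HasConicalCells M D ρ) (m : ℕ) {S : Set (Space (n + 1))} (hS : MeasurableSet S)
    (hsub : S ⊆ frontier M.Ω) :
    surfaceMeasure (slabTime M D m) S = (lateralMeasure M D m).restrict (univ ×ˢ S) := by
  have hfin : IsFiniteMeasure ((Measure.euclideanHausdorffMeasure n).restrict (frontier M.Ω)) :=
    ⟨by rw [Measure.restrict_apply_univ]; exact hD.measure_frontier_lt_top hρ hcone⟩
  change (volume.restrict (slabTime M D m)).prod
      ((Measure.euclideanHausdorffMeasure n).restrict S)
    = ((volume.restrict (slabTime M D m)).prod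
      ((Measure.euclideanHausdorffMeasure n).restrict (frontier M.Ω))).restrict (univ ×ˢ S)
  rw [← Measure.prod_restrict, Measure.restrict_univ, Measure.restrict_restrict hS,
    inter_eq_self_of_subset_left hsub]

theorem Admissible.lateralMeasure_eq_restrict (hD : Admissible M D ρ) (hρ : 0 < ρ)
    (hcone : HasConicalCells M D ρ) (m : ℕ) :
    lateralMeasure M D m = (lateralMeasure M D m).restrict
      (⋃ s : simplices M D, univ ×ˢ (frontier M.Ω ∩ closure (cell M s))) := by
  rw [← prod_iUnion, ← hD.frontier_eq hρ,
    ← hD.surfaceMeasure_cell_eq hρ hcone m isClosed_frontier.measurableSet subset_rfl]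
  rfl

/-- The boundary pieces cover `∂Ω` but may overlap, so countable subadditivity is used. -/
theorem Admissible.sqNorm_lateral_le (hD : Admissible M D ρ) (hρ : 0 < ρ)
    (hcone : HasConicalCells M D ρ) (m : ℕ) (g : SpaceTime (n + 1) → ℝ) :
    sqNorm (lateralMeasure M D m) g ≤ ∑' s : simplices M D,
      sqNorm (surfaceMeasure (slabTime M D m) (frontier M.Ω ∩ closure (cell M s))) g := by
  have : Countable (simplices M D) := hD.finite_simplices.countable
  rw [hD.lateralMeasure_eq_restrict hρ hcone m]
  refine (lintegral_iUnion_le _ _).trans_eq (tsum_congr fun s => ?_)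
  rw [hD.surfaceMeasure_cell_eq hρ hcone m (measurableSet_cellBoundary _) inter_subset_left]
  rfl

theorem Admissible.aemeasurable_lateralTrace (hD : Admissible M D ρ) (hρ : 0 < ρ)
    (hcone : HasConicalCells M D ρ) (m : ℕ) (w : SpaceTime (n + 1) → ℝ) :
    AEMeasurable (lateralTrace M D m w) (lateralMeasure M D m) := by
  have : Countable (simplices M D) := hD.finite_simplices.countable
  by_cases hex : ∃ g, IsLateralTrace M D m w g
  · rw [lateralTrace, dif_pos hex, hD.lateralMeasure_eq_restrict hρ hcone m]
    refine aemeasurable_iUnion_iff.2 fun s => ?_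
    rw [← hD.surfaceMeasure_cell_eq hρ hcone m (measurableSet_cellBoundary _) inter_subset_left]
    exact (hex.choose_spec s s.2).1.1.aemeasurable
  · rw [lateralTrace, dif_neg hex]
    exact aemeasurable_const

theorem Admissible.tsum_sqNorm_cell_le (hD : Admissible M D ρ) (m : ℕ)
    (f : SpaceTime (n + 1) → ℝ) :
    ∑' s : simplices M D, sqNorm (volume.restrict (slabTime M D m ×ˢ cell M s)) f
      ≤ sqNorm (volume.restrict (slab M D m)) f := by
  have : Countable (simplices M D) := hD.finite_simplices.countable
  simp only [sqNorm]
  rw [← lintegral_iUnion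
    (fun s : simplices M D => ((isOpen_slabTime m).prod (isOpen_cell _)).measurableSet)]
  · refine lintegral_mono_set (iUnion_subset fun s => ?_)
    exact prod_mono_right (cell_subset _)
  · intro s t hst
    refine Set.disjoint_prod.2 (Or.inr ?_)
    exact pairwiseDisjoint_cell s.2 t.2 fun h => hst (Subtype.ext h)

theorem Admissible.sqNorm_lateralTrace_flux_le (hD : Admissible M D ρ) (hρ : 0 < ρ)
    (hcone : HasConicalCells M D ρ) {b B : ℝ} (hB : 0 ≤ B)
    (hc : ∀ s ∈ simplices M D, IsSmoothSpeed M b B (cell M s))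
    {U : (SpaceTime (n + 1) → ℝ) × (SpaceTime (n + 1) → ℝ)} (hU : IsRegular M D U) {m : ℕ}
    (hm : m < D.N) (i : Fin (n + 1)) :
    sqNorm (lateralMeasure M D m) (lateralTrace M D m (flux M D m i U.1)) ≤
      ENNReal.ofReal (4 * traceConst n ρ * (1 + (n + 1) * (2 + 4 * B ^ 2)) * D.h⁻¹) *
        (sqNorm (volume.restrict (slab M D m)) (flux M D m i U.1)
          + ∑' s : simplices M D, ENNReal.ofReal (D.h ^ 2) *
            sqNormL2H2 (slabTime M D m) (cell M s) (fun z => M.c z.2 ^ 2 * U.1 z)) := by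
  have hh := hD.pos_h
  by_cases hex : ∃ g, IsLateralTrace M D m (flux M D m i U.1) g
  swap
  · rw [lateralTrace, dif_neg hex]
    -- Without a trace the chosen value is `0` and the bound is trivial.
    simp [sqNorm]
  rw [lateralTrace, dif_pos hex]
  have hg := hex.choose_spec
  set g := hex.choose
  set w := flux M D m i U.1
  set E : simplices M D → ℝ≥0∞ := fun s =>
    sqNormL2H2 (slabTime M D m) (cell M s) (fun z => M.c z.2 ^ 2 * U.1 z)
  set κ : ℝ := 2 + 4 * B ^ 2
  have hκ : 0 ≤ κ := by positivity
  have htc : 0 ≤ traceConst n ρ := by rw [traceConst]; positivity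
  have hcell : ∀ s : simplices M D,
      sqNorm (surfaceMeasure (slabTime M D m) (frontier M.Ω ∩ closure (cell M s))) g ≤
        ENNReal.ofReal (4 * traceConst n ρ) * (ENNReal.ofReal D.h⁻¹ *
          sqNorm (volume.restrict (slabTime M D m ×ˢ cell M s)) w
          + ENNReal.ofReal D.h⁻¹ * (ENNReal.ofReal ((n + 1) * κ) *
            (ENNReal.ofReal (D.h ^ 2) * E s))) := by
    intro s
    obtain ⟨e, x₀, hS⟩ := hcone s s.2
    have hw : AEMeasurable w (volume.restrict (slabTime M D m ×ˢ cell M s)) :=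
      (hD.aemeasurable_flux hc m i U.1).mono_measure
        (Measure.restrict_mono (prod_mono_right (cell_subset _)) le_rfl)
    refine (IsTrace.sqNorm_le hS hρ hh (isOpen_cell _) (measurableSet_cellBoundary _) hw
      (fun l => aemeasurable_weakDeriv _ _ _) (hg s s.2)).trans ?_
    gcongr _ * (_ + ?_)
    calc ENNReal.ofReal D.h * ∑ l, sqNorm (volume.restrict (slabTime M D m ×ˢ cell M s))
            (weakDeriv (slabTime M D m ×ˢ cell M s) w (dirX l))
        ≤ ENNReal.ofReal D.h * ∑ _l : Fin (n + 1), ENNReal.ofReal κ * E s := by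
          gcongr with l
          exact hU.sqNorm_weakDeriv_flux_le hm s.2 hB (hc s s.2) i l
      -- Writing `h = h⁻¹h²` matches the weight `h²` of the `H²` term and leaves a common factor
      -- `h⁻¹`; `n + 1` counts the partial derivatives.
      _ = ENNReal.ofReal D.h⁻¹ * (ENNReal.ofReal ((n + 1) * κ) *
            (ENNReal.ofReal (D.h ^ 2) * E s)) := by
          rw [Finset.sum_const, Finset.card_univ, Fintype.card_fin, nsmul_eq_mul,
            ← ENNReal.ofReal_natCast, ← mul_assoc, ← mul_assoc, ← mul_assoc, ← mul_assoc,
            ← ENNReal.ofReal_mul hh.le, ← ENNReal.ofReal_mul (by positivity),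
            ← ENNReal.ofReal_mul (by positivity), ← ENNReal.ofReal_mul (by positivity)]
          congr 2
          push_cast
          field_simp
  refine (hD.sqNorm_lateral_le hρ hcone m g).trans ((ENNReal.tsum_le_tsum hcell).trans ?_)
  rw [ENNReal.tsum_mul_left, ENNReal.tsum_add, ENNReal.tsum_mul_left, ENNReal.tsum_mul_left,
    ENNReal.tsum_mul_left]
  have hsum := hD.tsum_sqNorm_cell_le m w
  set X := sqNorm (volume.restrict (slab M D m)) w
  set Z := ∑' s : simplices M D, ENNReal.ofReal (D.h ^ 2) * E s
  calc _ ≤ ENNReal.ofReal (4 * traceConst n ρ) * (ENNReal.ofReal D.h⁻¹ * X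
          + ENNReal.ofReal D.h⁻¹ * (ENNReal.ofReal ((n + 1) * κ) * Z)) := by gcongr
    _ ≤ ENNReal.ofReal (4 * traceConst n ρ) * (ENNReal.ofReal D.h⁻¹ * X
          + ENNReal.ofReal D.h⁻¹ * (ENNReal.ofReal ((n + 1) * κ) * Z)
          + ENNReal.ofReal D.h⁻¹ * (ENNReal.ofReal ((n + 1) * κ) * X + Z)) := by
        gcongr _ * ?_; exact le_self_add
    _ = _ := by
        rw [ENNReal.ofReal_mul (p := 4 * traceConst n ρ * _) (by positivity),
          ENNReal.ofReal_mul (p := 4 * traceConst n ρ) (by positivity),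
          ENNReal.ofReal_add zero_le_one (by positivity), ENNReal.ofReal_one]
        ring

end

/-! ### Continuity of the bilinear form -/

section

variable {α : Type} [MeasurableSpace α] {μ : Measure α}

theorem lintegral_enorm_mul_le {f g : α → ℝ} (hf : AEMeasurable f μ) (hg : AEMeasurable g μ) :
    ∫⁻ z, ‖f z * g z‖ₑ ∂μ ≤ sqNorm μ f ^ (1 / 2 : ℝ) * sqNorm μ g ^ (1 / 2 : ℝ) := by
  have h := ENNReal.lintegral_mul_le_Lp_mul_Lq μ Real.HolderConjugate.two_two hf.enorm hg.enorm
  simp only [ENNReal.rpow_two] at h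
  simp only [enorm_mul]
  exact h

/-- This lets weights that are powers of `h` sit on the two factors separately and cancel in the
product `ab`. -/
theorem rpow_half_mul_le {X Y A B : ℝ≥0∞} {a b c : ℝ} (ha : 0 ≤ a) (hc : 0 ≤ c)
    (hX : X ≤ ENNReal.ofReal a * A) (hY : Y ≤ ENNReal.ofReal b * B) (hab : a * b = c ^ 2) :
    X ^ (1 / 2 : ℝ) * Y ^ (1 / 2 : ℝ)
      ≤ ENNReal.ofReal c * (A ^ (1 / 2 : ℝ) * B ^ (1 / 2 : ℝ)) := by
  have h2 : (0 : ℝ) ≤ 1 / 2 := by norm_num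
  rw [← ENNReal.mul_rpow_of_nonneg _ _ h2, ← ENNReal.mul_rpow_of_nonneg _ _ h2]
  calc (X * Y) ^ (1 / 2 : ℝ)
      ≤ (ENNReal.ofReal a * A * (ENNReal.ofReal b * B)) ^ (1 / 2 : ℝ) := by gcongr
    _ = (ENNReal.ofReal (c ^ 2) * (A * B)) ^ (1 / 2 : ℝ) := by
        rw [← hab, ENNReal.ofReal_mul ha]; ring_nf
    _ = ENNReal.ofReal c * (A * B) ^ (1 / 2 : ℝ) := by
        rw [ENNReal.mul_rpow_of_nonneg _ _ h2, ENNReal.ofReal_pow hc, ← ENNReal.rpow_two,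
          ← ENNReal.rpow_mul]
        norm_num

end

theorem abs_outerNormal_apply_le {d : ℕ} (O : Set (Space d)) (x : Space d) (i : Fin d) :
    |outerNormal O x i| ≤ 1 := by
  by_cases h : ∃ ν, IsOuterNormal O x ν
  · rw [outerNormal, dif_pos h, ← h.choose_spec.1]
    exact PiLp.norm_apply_le h.choose i
  · rw [outerNormal, dif_neg h]
    simp

/-! ### The four terms of the form on a time slab -/

section

variable {n : ℕ} {M : Medium (n + 1)} {D : Discretization (n + 1)} {ρ : ℝ}

/-- The squared norm of `U` on the time slab `Q^m` that controls `A[U, ·]`. -/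
def sqSlabPrimal (M : Medium (n + 1)) (D : Discretization (n + 1)) (m : ℕ)
    (U : (SpaceTime (n + 1) → ℝ) × (SpaceTime (n + 1) → ℝ)) : ℝ≥0∞ :=
  sqNorm (volume.restrict (slab M D m)) (timeDeriv M D m U.2)
    + ∑ i, sqNorm (volume.restrict (slab M D m)) (flux M D m i U.1)
    + sqNorm (volume.restrict (slab M D m)) (timeDeriv M D m U.1)
    + sqNorm (volume.restrict (slab M D m)) U.2
    + ∑' s : simplices M D, ENNReal.ofReal (D.h ^ 2) *
        sqNormL2H2 (slabTime M D m) (cell M s) (fun z => M.c z.2 ^ 2 * U.1 z)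

/-- The squared norm of `Z` on the time slab `Q^m`. -/
def sqSlabDual (M : Medium (n + 1)) (D : Discretization (n + 1)) (m : ℕ)
    (Z : (SpaceTime (n + 1) → ℝ) × (SpaceTime (n + 1) → ℝ)) : ℝ≥0∞ :=
  sqNorm (volume.restrict (slab M D m)) Z.1
    + ∑ i, sqNorm (volume.restrict (slab M D m)) (fun z => M.c z.2 * spaceDeriv M D m i Z.1 z)
    + sqNorm (volume.restrict (slab M D m)) Z.2
    + ENNReal.ofReal D.h⁻¹ * sqNorm (lateralMeasure M D m) (lateralTrace M D m Z.1)

variable {U Y : (SpaceTime (n + 1) → ℝ) × (SpaceTime (n + 1) → ℝ)} {m : ℕ}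

theorem Admissible.enorm_integral_flux_le (hD : Admissible M D ρ) {b B : ℝ} (hb : 0 < b)
    (hc : ∀ s ∈ simplices M D, IsSmoothSpeed M b B (cell M s)) :
    ‖∫ z in slab M D m, ∑ i, flux M D m i U.1 z * spaceDeriv M D m i Y.1 z‖ₑ
      ≤ ENNReal.ofReal ((n + 1) * b⁻¹) *
        (sqSlabPrimal M D m U ^ (1 / 2 : ℝ) * sqSlabDual M D m Y ^ (1 / 2 : ℝ)) := by
  have hcb : ∀ᵐ z ∂volume.restrict (slab M D m), b ≤ M.c z.2 :=
    ae_slab_of_ae (hD.ae_mem_cell.mono fun x ⟨s, hs, hx⟩ => (hc s hs).le_c x hx) m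
  have hterm : ∀ i, ∫⁻ z in slab M D m, ‖flux M D m i U.1 z * spaceDeriv M D m i Y.1 z‖ₑ
      ≤ ENNReal.ofReal b⁻¹ *
        (sqSlabPrimal M D m U ^ (1 / 2 : ℝ) * sqSlabDual M D m Y ^ (1 / 2 : ℝ)) := by
    intro i
    refine (lintegral_enorm_mul_le (hD.aemeasurable_flux hc m i U.1)
      (aemeasurable_weakDeriv _ _ _)).trans ?_
    refine rpow_half_mul_le (a := 1) (b := b⁻¹ ^ 2) zero_le_one (by positivity)
      ?_ ?_ (one_mul _)
    · rw [ENNReal.ofReal_one, one_mul]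
      have h₁ : sqNorm (volume.restrict (slab M D m)) (flux M D m i U.1)
          ≤ ∑ i, sqNorm (volume.restrict (slab M D m)) (flux M D m i U.1) :=
        Finset.single_le_sum (f := fun i => sqNorm (volume.restrict (slab M D m))
          (flux M D m i U.1)) (fun _ _ => zero_le) (Finset.mem_univ i)
      rw [sqSlabPrimal, add_assoc, add_assoc, add_assoc]
      exact (h₁.trans le_self_add).trans le_add_self
    · have h₁ : sqNorm (volume.restrict (slab M D m)) (fun z => M.c z.2 * spaceDeriv M D m i Y.1 z)
          ≤ ∑ i, sqNorm (volume.restrict (slab M D m))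
            (fun z => M.c z.2 * spaceDeriv M D m i Y.1 z) :=
        Finset.single_le_sum (f := fun i => sqNorm (volume.restrict (slab M D m))
          (fun z => M.c z.2 * spaceDeriv M D m i Y.1 z)) (fun _ _ => zero_le) (Finset.mem_univ i)
      -- The dual norm contains `c∇y₁`, so the plain gradient costs a factor `b⁻¹`.
      have h₂ : sqNorm (volume.restrict (slab M D m)) (spaceDeriv M D m i Y.1)
          ≤ sqNorm (volume.restrict (slab M D m))
            (fun z => b⁻¹ * (M.c z.2 * spaceDeriv M D m i Y.1 z)) := by
        refine sqNorm_mono_ae (hcb.mono fun z hz => ?_)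
        rw [← mul_assoc, abs_mul]
        refine le_mul_of_one_le_left (abs_nonneg _) ?_
        rw [abs_of_nonneg (mul_nonneg (by positivity) (hb.le.trans hz))]
        rwa [one_le_inv_mul₀ hb]
      rw [sqNorm_const_mul] at h₂
      refine h₂.trans ?_
      gcongr
      rw [sqSlabDual, add_assoc, add_assoc]
      exact (h₁.trans le_self_add).trans le_add_self
  calc _ ≤ ∫⁻ z in slab M D m, ‖∑ i, flux M D m i U.1 z * spaceDeriv M D m i Y.1 z‖ₑ :=
        enorm_integral_le_lintegral_enorm _
    _ ≤ ∫⁻ z in slab M D m, ∑ i, ‖flux M D m i U.1 z * spaceDeriv M D m i Y.1 z‖ₑ :=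
        lintegral_mono fun z => enorm_sum_le _ _
    _ = ∑ i, ∫⁻ z in slab M D m, ‖flux M D m i U.1 z * spaceDeriv M D m i Y.1 z‖ₑ :=
        lintegral_finsetSum' _ fun i _ => ((hD.aemeasurable_flux hc m i U.1).mul
          (aemeasurable_weakDeriv _ _ _)).enorm
    _ ≤ ∑ _i : Fin (n + 1), ENNReal.ofReal b⁻¹ *
        (sqSlabPrimal M D m U ^ (1 / 2 : ℝ) * sqSlabDual M D m Y ^ (1 / 2 : ℝ)) :=
        Finset.sum_le_sum fun i _ => hterm i
    _ = _ := by
        rw [Finset.sum_const, Finset.card_univ, Fintype.card_fin, nsmul_eq_mul, ← mul_assoc,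
          ← ENNReal.ofReal_natCast, ← ENNReal.ofReal_mul (by positivity)]
        push_cast
        rfl

/-- The trace of the flux is of size `h^(-1/2)` and that of `y₁` of size `h^(1/2)` relative to the
norms, so the two weights cancel. The components of the normal are at most `1` in absolute value. -/
theorem Admissible.enorm_integral_lateral_le (hD : Admissible M D ρ) (hρ : 0 < ρ)
    (hcone : HasConicalCells M D ρ) {b B : ℝ} (hB : 0 ≤ B)
    (hc : ∀ s ∈ simplices M D, IsSmoothSpeed M b B (cell M s)) (hU : IsRegular M D U)
    (hm : m < D.N) :
    ‖∫ z, lateralFlux M D m U.1 z * lateralTrace M D m Y.1 z ∂lateralMeasure M D m‖ₑ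
      ≤ ENNReal.ofReal ((n + 1) * √(4 * traceConst n ρ * (1 + (n + 1) * (2 + 4 * B ^ 2)))) *
        (sqSlabPrimal M D m U ^ (1 / 2 : ℝ) * sqSlabDual M D m Y ^ (1 / 2 : ℝ)) := by
  have hh := hD.pos_h
  have htc : 0 ≤ traceConst n ρ := by rw [traceConst]; positivity
  have hYm := hD.aemeasurable_lateralTrace hρ hcone m Y.1
  have hFm := fun i => hD.aemeasurable_lateralTrace hρ hcone m (flux M D m i U.1)
  have hterm : ∀ i, ∫⁻ z, ‖lateralTrace M D m (flux M D m i U.1) z * lateralTrace M D m Y.1 z‖ₑ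
      ∂lateralMeasure M D m
      ≤ ENNReal.ofReal √(4 * traceConst n ρ * (1 + (n + 1) * (2 + 4 * B ^ 2))) *
        (sqSlabPrimal M D m U ^ (1 / 2 : ℝ) * sqSlabDual M D m Y ^ (1 / 2 : ℝ)) := by
    intro i
    refine (lintegral_enorm_mul_le (hFm i) hYm).trans ?_
    refine rpow_half_mul_le
      (a := 4 * traceConst n ρ * (1 + (n + 1) * (2 + 4 * B ^ 2)) * D.h⁻¹) (b := D.h)
      (by positivity) (Real.sqrt_nonneg _) ?_ ?_ ?_
    · refine (hD.sqNorm_lateralTrace_flux_le hρ hcone hB hc hU hm i).trans ?_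
      gcongr
      rw [sqSlabPrimal]
      refine add_le_add_left ?_ _
      have h₁ : sqNorm (volume.restrict (slab M D m)) (flux M D m i U.1)
          ≤ ∑ i, sqNorm (volume.restrict (slab M D m)) (flux M D m i U.1) :=
        Finset.single_le_sum (f := fun i => sqNorm (volume.restrict (slab M D m))
          (flux M D m i U.1)) (fun _ _ => zero_le) (Finset.mem_univ i)
      exact ((h₁.trans le_add_self).trans le_self_add).trans le_self_add
    · have h₁ : ENNReal.ofReal D.h * (ENNReal.ofReal D.h⁻¹ *
          sqNorm (lateralMeasure M D m) (lateralTrace M D m Y.1))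
          = sqNorm (lateralMeasure M D m) (lateralTrace M D m Y.1) := by
        rw [← mul_assoc, ← ENNReal.ofReal_mul hh.le, mul_inv_cancel₀ hh.ne', ENNReal.ofReal_one,
          one_mul]
      rw [← h₁]
      gcongr
      exact le_add_self
    · rw [Real.sq_sqrt (by positivity), mul_assoc, inv_mul_cancel₀ hh.ne', mul_one]
  calc _ ≤ ∫⁻ z, ‖lateralFlux M D m U.1 z * lateralTrace M D m Y.1 z‖ₑ ∂lateralMeasure M D m :=
        enorm_integral_le_lintegral_enorm _
    _ ≤ ∫⁻ z, ∑ i, ‖lateralTrace M D m (flux M D m i U.1) z * lateralTrace M D m Y.1 z‖ₑ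
          ∂lateralMeasure M D m := by
        refine lintegral_mono fun z => ?_
        rw [lateralFlux, Finset.sum_mul]
        refine (enorm_sum_le _ _).trans (Finset.sum_le_sum fun i _ => ?_)
        rw [enorm_le_iff_norm_le, norm_mul, norm_mul, norm_mul]
        gcongr
        exact mul_le_of_le_one_right (norm_nonneg _) (abs_outerNormal_apply_le _ _ _)
    _ = ∑ i, ∫⁻ z, ‖lateralTrace M D m (flux M D m i U.1) z * lateralTrace M D m Y.1 z‖ₑ
          ∂lateralMeasure M D m :=
        lintegral_finsetSum' _ fun i _ => ((hFm i).mul hYm).enorm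
    _ ≤ ∑ _i : Fin (n + 1), ENNReal.ofReal
          √(4 * traceConst n ρ * (1 + (n + 1) * (2 + 4 * B ^ 2))) *
        (sqSlabPrimal M D m U ^ (1 / 2 : ℝ) * sqSlabDual M D m Y ^ (1 / 2 : ℝ)) :=
        Finset.sum_le_sum fun i _ => hterm i
    _ = _ := by
        rw [Finset.sum_const, Finset.card_univ, Fintype.card_fin, nsmul_eq_mul, ← mul_assoc,
          ← ENNReal.ofReal_natCast, ← ENNReal.ofReal_mul (by positivity)]
        push_cast
        rfl

theorem enorm_integral_timeDeriv_le {k q : ℕ} (hY : MemFullyDiscrete M D k q Y.1)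
    (hm : m < D.N) :
    ‖∫ z in slab M D m, timeDeriv M D m U.2 z * Y.1 z‖ₑ
      ≤ sqSlabPrimal M D m U ^ (1 / 2 : ℝ) * sqSlabDual M D m Y ^ (1 / 2 : ℝ) := by
  refine (enorm_integral_le_lintegral_enorm _).trans ((lintegral_enorm_mul_le
    (aemeasurable_weakDeriv _ _ _) (hY.aemeasurable hm)).trans ?_)
  gcongr
  · simp only [sqSlabPrimal, add_assoc]
    exact le_self_add
  · simp only [sqSlabDual, add_assoc]
    exact le_self_add

theorem IsRegular.enorm_integral_sub_le (hU : IsRegular M D U) {k q : ℕ}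
    (hY : MemFullyDiscrete M D k q Y.2) (hm : m < D.N) :
    ‖∫ z in slab M D m, (timeDeriv M D m U.1 z - U.2 z) * Y.2 z‖ₑ
      ≤ 2 * (sqSlabPrimal M D m U ^ (1 / 2 : ℝ) * sqSlabDual M D m Y ^ (1 / 2 : ℝ)) := by
  have hYm := hY.aemeasurable hm
  have hTm : AEMeasurable (timeDeriv M D m U.1) (volume.restrict (slab M D m)) :=
    aemeasurable_weakDeriv _ _ _
  have hUm : AEMeasurable U.2 (volume.restrict (slab M D m)) := (hU m hm).2.2.1.1.aemeasurable
  have hdual : sqNorm (volume.restrict (slab M D m)) Y.2 ≤ sqSlabDual M D m Y :=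
    le_add_self.trans le_self_add
  calc _ ≤ ∫⁻ z in slab M D m, ‖(timeDeriv M D m U.1 z - U.2 z) * Y.2 z‖ₑ :=
        enorm_integral_le_lintegral_enorm _
    _ ≤ ∫⁻ z in slab M D m, (‖timeDeriv M D m U.1 z * Y.2 z‖ₑ + ‖U.2 z * Y.2 z‖ₑ) := by
        refine lintegral_mono fun z => ?_
        rw [sub_mul]
        exact enorm_sub_le
    _ = (∫⁻ z in slab M D m, ‖timeDeriv M D m U.1 z * Y.2 z‖ₑ)
          + ∫⁻ z in slab M D m, ‖U.2 z * Y.2 z‖ₑ :=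
        lintegral_add_left' (hTm.mul hYm).enorm _
    _ ≤ sqSlabPrimal M D m U ^ (1 / 2 : ℝ) * sqSlabDual M D m Y ^ (1 / 2 : ℝ)
          + sqSlabPrimal M D m U ^ (1 / 2 : ℝ) * sqSlabDual M D m Y ^ (1 / 2 : ℝ) := by
        refine add_le_add ((lintegral_enorm_mul_le hTm hYm).trans ?_)
          ((lintegral_enorm_mul_le hUm hYm).trans ?_)
        · gcongr
          exact (le_add_self.trans le_self_add).trans le_self_add
        · gcongr
          exact le_add_self.trans le_self_add
    _ = _ := (two_mul _).symm

theorem Admissible.enorm_formA_le (hD : Admissible M D ρ) (hρ : 0 < ρ)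
    (hcone : HasConicalCells M D ρ) {b B : ℝ} (hb : 0 < b) (hB : 0 ≤ B)
    (hc : ∀ s ∈ simplices M D, IsSmoothSpeed M b B (cell M s)) (hU : IsRegular M D U) {k q : ℕ}
    (hY₁ : MemFullyDiscrete M D k q Y.1) (hY₂ : MemFullyDiscrete M D k q Y.2) :
    ‖formA M D U Y‖ₑ ≤ ENNReal.ofReal (3 + (n + 1) * b⁻¹
        + (n + 1) * √(4 * traceConst n ρ * (1 + (n + 1) * (2 + 4 * B ^ 2)))) *
      ((∑ m ∈ Finset.range D.N, sqSlabPrimal M D m U) ^ (1 / 2 : ℝ) *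
        (∑ m ∈ Finset.range D.N, sqSlabDual M D m Y) ^ (1 / 2 : ℝ)) := by
  set C₂ : ℝ := (n + 1) * b⁻¹
  set C₄ : ℝ := (n + 1) * √(4 * traceConst n ρ * (1 + (n + 1) * (2 + 4 * B ^ 2)))
  have hC₂ : 0 ≤ C₂ := by positivity
  have hC₄ : 0 ≤ C₄ := by positivity
  have hC : ENNReal.ofReal (3 + C₂ + C₄) = 1 + ENNReal.ofReal C₂ + 2 + ENNReal.ofReal C₄ := by
    rw [ENNReal.ofReal_add (by positivity) hC₄, ENNReal.ofReal_add (by norm_num) hC₂,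
      show ENNReal.ofReal 3 = 1 + 2 by norm_num]
    ring
  have hslab : ∀ m ∈ Finset.range D.N,
      ‖(∫ z in slab M D m, timeDeriv M D m U.2 z * Y.1 z)
        + (∫ z in slab M D m, ∑ i, flux M D m i U.1 z * spaceDeriv M D m i Y.1 z)
        + (∫ z in slab M D m, (timeDeriv M D m U.1 z - U.2 z) * Y.2 z)
        - ∫ z, lateralFlux M D m U.1 z * lateralTrace M D m Y.1 z ∂lateralMeasure M D m‖ₑ
      ≤ ENNReal.ofReal (3 + C₂ + C₄) *
        (sqSlabPrimal M D m U ^ (1 / 2 : ℝ) * sqSlabDual M D m Y ^ (1 / 2 : ℝ)) := by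
    intro m hm
    rw [Finset.mem_range] at hm
    rw [hC, add_mul, add_mul, add_mul, one_mul]
    refine enorm_sub_le.trans (add_le_add ((enorm_add_le _ _).trans (add_le_add
      ((enorm_add_le _ _).trans (add_le_add ?_ ?_)) ?_)) ?_)
    · exact enorm_integral_timeDeriv_le hY₁ hm
    · exact hD.enorm_integral_flux_le hb hc
    · exact hU.enorm_integral_sub_le hY₂ hm
    · exact hD.enorm_integral_lateral_le hρ hcone hB hc hU hm
  -- Since the slab constant does not depend on `m`, Cauchy–Schwarz over the slabs sums the bounds.
  have hCS := ENNReal.inner_le_Lp_mul_Lq (Finset.range D.N)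
    (fun m => sqSlabPrimal M D m U ^ (1 / 2 : ℝ)) (fun m => sqSlabDual M D m Y ^ (1 / 2 : ℝ))
    Real.HolderConjugate.two_two
  have hsq : ∀ x : ℝ≥0∞, (x ^ (1 / 2 : ℝ)) ^ (2 : ℝ) = x := fun x => by
    rw [← ENNReal.rpow_mul]; norm_num
  simp only [hsq] at hCS
  calc ‖formA M D U Y‖ₑ ≤ _ := enorm_sum_le _ _
    _ ≤ _ := Finset.sum_le_sum hslab
    _ ≤ _ := by
        rw [← Finset.mul_sum]
        gcongr

end

end WaveDA

end

theorem mainTheorem6 {d : ℕ} (hd₁ : 1 ≤ d) (hd₃ : d ≤ 3) (M : WaveDA.Medium d)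
    (ρ : ℝ) (hρ : 0 < ρ) :
    ∃ h₀ : ℝ, 0 < h₀ ∧ ∃ C : ℝ, 0 < C ∧
      ∀ D : WaveDA.Discretization d, WaveDA.Admissible M D ρ → D.h ≤ h₀ →
      ∀ k q : ℕ, 1 ≤ k →
      ∀ U : (WaveDA.SpaceTime d → ℝ) × (WaveDA.SpaceTime d → ℝ), WaveDA.IsRegular M D U →
      ∀ Y : (WaveDA.SpaceTime d → ℝ) × (WaveDA.SpaceTime d → ℝ),
        WaveDA.MemFullyDiscrete M D k q Y.1 → WaveDA.MemFullyDiscrete M D k q Y.2 →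
        ENNReal.ofReal (WaveDA.formA M D U Y) ≤
          ENNReal.ofReal C * WaveDA.tnormBox M D U 0 * WaveDA.tnorm M D 0 Y := by
  -- Here `n` is the dimension of the boundary.
  obtain ⟨n, rfl⟩ : ∃ n, d = n + 1 := ⟨d - 1, by omega⟩
  obtain ⟨h₀, hh₀, hcone⟩ := WaveDA.exists_isConeBase_cell M hd₁ hρ
  obtain ⟨b, hb, B, hB, hspeed⟩ := M.exists_isSmoothSpeed
  refine ⟨h₀, hh₀, 3 + (n + 1) * b⁻¹ + (n + 1) *
    √(4 * WaveDA.traceConst n ρ * (1 + (n + 1) * (2 + 4 * B ^ 2))), by positivity, ?_⟩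
  intro D hD hle k q _ U hU Y hY₁ hY₂
  refine (Real.ofReal_le_enorm _).trans ((hD.enorm_formA_le hρ (hcone D hD hle) hb hB
    (fun s hs => hspeed _ (hD.fits_interface s hs)) hU hY₁ hY₂).trans ?_)
  rw [mul_assoc _ (WaveDA.tnormBox M D U 0)]
  gcongr
  -- Each sum of slab norms is the last summand of the corresponding squared norm; the other
  -- summands are nonnegative and dropped, so their values, finite or not, play no role.
  · exact ENNReal.rpow_le_rpow le_add_self one_half_pos.le
  · exact ENNReal.rpow_le_rpow le_add_self one_half_pos.le
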